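/- **Theorem 4 (Optimal correct-decoding exponent).** Let $\mathcal X,\mathcal Y$ be finite non-empty alphabets, $W(y\,|\,x)$ transition probabilities, and $R,K>0$. All logarithms are natural, $|t|^+=\max\{0,t\}$. *Channel ensemble.* A codebook $\mathcal C_n$ consists of $\lfloor e^{nR}\rfloor$ (not necessarily distinct) codewords $\mathbf x_m\in\mathcal X^n$. A channel instance consists of a cloud of $\lfloor e^{nK}\rfloor$ words of $\mathcal Y^n$ for every message $m$; all words are generated independently, each word in the cloud of $m$ by the memoryless law $\prod_i W(\cdot\,|\,x_{mi})$. The message $m$ is uniform, and the received word $\widehat{\mathbf y}$ is a uniformly chosen member of the cloud of $m$ (replicas counted). The decoder knows the codebook and the instance. $P_e(\mathcal C_n)$ is the error probability of the maximum-likelihood decoder (ties broken uniformly at random), averaged over messages and channel instances; $\overline P_e^{(n)}(P)$ is its average over codebooks whose letters are all i.i.d. with law $P$ on $\mathcal X$. *Exponents.* For a joint distribution $PU=P(x)U(y|x)$, respectively $TV=T(y)V(x|y)$, let $B=\mathbb E[-\log W(Y|X)]$ under that distribution and let $I_{PU}$ be the mutual information. Define $$E_c(R,K)=\min_{PU}\Big\{D(U\|W|P)+\big|R-I_{PU}-|B_{PU}-K|^+\big|^+\Big\},$$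 $$E_c(P,R,K)=\min_{TV}\Big\{D(TV\|PW)+\big|R-D(V\|P|T)-|B_{TV}-K|^+\big|^+\Big\},$$ with $D(U\|W|P)=\sum_{x,y}P(x)U(y|x)\log\frac{U(y|x)}{W(y|x)}$ and $D(V\|P|T)=\sum_{x,y}T(y)V(x|y)\log\frac{V(x|y)}{P(x)}$. Then both minima are attained, $E_c(R,K)=\min_P E_c(P,R,K)$ (attained as well), and the following limit exists and satisfies $$\lim_{n\to\infty}\ \min_{\mathcal C_n}\ -\tfrac1n\log\big[1-P_e(\mathcal C_n)\big]=E_c(R,K).$$ This exponent is achieved by random coding: for every $P$ with $E_c(P,R,K)=E_c(R,K)$, $$\lim_{n\to\infty}-\tfrac1n\log\big[1-\overline P_e^{(n)}(P)\big]=E_c(R,K),$$ and there are joint types $\tau_n$ with denominator $n$ on $\mathcal X\times\mathcal Y$ such that the same limit (with positive probabilities of correct decoding for all large $n$) holds if the maximum-likelihood decoder is replaced by the suboptimal decoder that chooses uniformly at random among the messages $m$ for which $(\mathbf x_m,\widehat{\mathbf y})$ has joint type $\tau_n$ and $\widehat{\mathbf y}$ occurs at least once in the cloud of $m$, and declares an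 error if there is no such message. -/

import Mathlib

open Filter Topology

noncomputable section

/-! ### Information quantities on finite alphabets (natural logarithms, values in `[-∞, ∞]`) -/

/-- `U a b` is a conditional distribution `U(b | a)`. -/
def IsKernel {α β : Type*} [Fintype β] (U : α → β → ℝ) : Prop :=
  ∀ a, U a ∈ stdSimplex ℝ β

/-- `p log (p / q)`, with `0 log (0 / q) = 0` and `p log (p / 0) = +∞` for `p ≠ 0`. -/
def klTerm (p q : ℝ) : EReal :=
  if p = 0 then 0 else if q = 0 then ⊤ else ((p * Real.log (p / q) : ℝ) : EReal)

/-- The Kullback-Leibler divergence `D(p ‖ q)`. -/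
def relEnt {α : Type*} [Fintype α] (p q : α → ℝ) : EReal :=
  ∑ a, klTerm (p a) (q a)

/-- The averaged divergence `D(V ‖ Q | T) = ∑ T(a) V(b|a) log (V(b|a) / Q(b|a))`;
in `EReal` one has `0 * ⊤ = 0`, so letters of zero probability do not contribute. -/
def condRelEnt {α β : Type*} [Fintype α] [Fintype β] (T : α → ℝ) (V Q : α → β → ℝ) : EReal :=
  ∑ a, (T a : EReal) * relEnt (V a) (Q a)

/-- `-log w`, equal to `+∞` at `w = 0`. -/
def negLog (w : ℝ) : EReal :=
  if w = 0 then ⊤ else ((-Real.log w : ℝ) : EReal)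

variable {X Y : Type*} [Fintype X] [Fintype Y]

/-- The joint distribution `P(x) U(y|x)`. -/
def jointXY (P : X → ℝ) (U : X → Y → ℝ) : X × Y → ℝ := fun z => P z.1 * U z.1 z.2

/-- The joint distribution `T(y) V(x|y)`. -/
def jointYX (T : Y → ℝ) (V : Y → X → ℝ) : X × Y → ℝ := fun z => T z.2 * V z.2 z.1

/-- `B_Q = E_Q[-log W(Y|X)]` for a joint distribution `Q` of `(X, Y)`. -/
def crossEnt (W : X → Y → ℝ) (Q : X × Y → ℝ) : EReal :=
  ∑ z, (Q z : EReal) * negLog (W z.1 z.2)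

/-- The mutual information of a pair with joint distribution `Q`: the divergence of `Q` from the
product of its marginals. -/
def mutualInfo (Q : X × Y → ℝ) : EReal :=
  relEnt Q (fun z => (∑ y, Q (z.1, y)) * ∑ x, Q (x, z.2))

/-- `D(U ‖ W | P) + |R - I_{PU} - |B_{PU} - K|⁺|⁺`. -/
def EcObj (W : X → Y → ℝ) (R K : ℝ) (P : X → ℝ) (U : X → Y → ℝ) : EReal :=
  condRelEnt P U W +
    max 0 ((R : EReal) - mutualInfo (jointXY P U) -
      max 0 (crossEnt W (jointXY P U) - (K : EReal)))

/-- `E_c(R, K)`: the minimum of `EcObj` over all distributions `P` on `X` and all conditional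
distributions `U` on `Y` given `X`. -/
def Ec (W : X → Y → ℝ) (R K : ℝ) : EReal :=
  ⨅ (P : X → ℝ) (_ : P ∈ stdSimplex ℝ X) (U : X → Y → ℝ) (_ : IsKernel U), EcObj W R K P U

/-- `D(TV ‖ PW) + |R - D(V ‖ P | T) - |B_{TV} - K|⁺|⁺`. -/
def EcPObj (W : X → Y → ℝ) (P : X → ℝ) (R K : ℝ) (T : Y → ℝ) (V : Y → X → ℝ) : EReal :=
  relEnt (jointYX T V) (jointXY P W) +
    max 0 ((R : EReal) - condRelEnt T V (fun _ => P) -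
      max 0 (crossEnt W (jointYX T V) - (K : EReal)))

/-- `E_c(P, R, K)`: the minimum of `EcPObj` over all distributions `T` on `Y` and all conditional
distributions `V` on `X` given `Y`. -/
def EcP (W : X → Y → ℝ) (P : X → ℝ) (R K : ℝ) : EReal :=
  ⨅ (T : Y → ℝ) (_ : T ∈ stdSimplex ℝ Y) (V : Y → X → ℝ) (_ : IsKernel V), EcPObj W P R K T V

/-! ### The channel ensemble -/

/-- `⌊e^{nr}⌋`: the number of messages for `r = R`, the size of a cloud for `r = K`. -/
def expSize (n : ℕ) (r : ℝ) : ℕ := ⌊Real.exp (n * r)⌋₊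

/-- A codebook of `M` codewords of length `n`; codewords of different messages may coincide. -/
abbrev Codebook (X : Type*) (n M : ℕ) : Type _ := Fin M → Fin n → X

/-- A channel instance: for each of the `M` messages a cloud of `N` words of length `n`. -/
abbrev Clouds (Y : Type*) (n M N : ℕ) : Type _ := Fin M → Fin N → Fin n → Y

/-- A decoder that knows the codebook and the channel instance: `φ C c y m` is the probability
with which it decides for message `m` on receiving `y`. With the remaining probability it
declares an error. -/
abbrev Decoder (X Y : Type*) (n M N : ℕ) : Type _ :=
  Codebook X n M → Clouds Y n M N → (Fin n → Y) → Fin M → ℝ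

/-- The probability that the instance `c` is generated for the codebook `C`: all words of all
clouds are independent, each being an output of the memoryless channel `W`. -/
def instanceProb {n M N : ℕ} (W : X → Y → ℝ) (C : Codebook X n M) (c : Clouds Y n M N) : ℝ :=
  ∏ m, ∏ j, ∏ i, W (C m i) (c m j i)

/-- The error probability of a decoder for the codebook `C`, averaged over the instances, the
equiprobable messages `m`, and the uniformly chosen member `j` of the cloud of `m`. -/
def errProb {n M N : ℕ} (W : X → Y → ℝ) (φ : Decoder X Y n M N) (C : Codebook X n M) : ℝ :=
  ∑ c : Clouds Y n M N, instanceProb W C c *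
    ((1 / (M : ℝ)) * ∑ m, (1 / (N : ℝ)) * ∑ j, (1 - φ C c (c m j) m))

/-- The average of `errProb` over codebooks all of whose letters are i.i.d. with law `P`. -/
def avgErrProb {n M N : ℕ} (W : X → Y → ℝ) (φ : Decoder X Y n M N) (P : X → ℝ) : ℝ :=
  ∑ C : Codebook X n M, (∏ m, ∏ i, P (C m i)) * errProb W φ C

open Classical in
/-- The transition probability of the instance `c`: the fraction of the cloud of `m` that
equals `y`. -/
def transProb {n M N : ℕ} (c : Clouds Y n M N) (m : Fin M) (y : Fin n → Y) : ℝ :=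
  ((Finset.univ.filter fun j => c m j = y).card : ℝ) / N

/-- The random choice of an element of `S`, uniformly; an error is declared if `S` is empty. -/
def uniformChoice {M : ℕ} (S : Finset (Fin M)) (m : Fin M) : ℝ :=
  if m ∈ S then 1 / (S.card : ℝ) else 0

open Classical in
/-- The maximum-likelihood decoder, ties being broken uniformly. -/
def mlDecoder (X Y : Type*) [Fintype Y] (n M N : ℕ) : Decoder X Y n M N := fun _ c y =>
  uniformChoice (Finset.univ.filter fun m => ∀ m', transProb c m' y ≤ transProb c m y)

open Classical in
/-- `n` times the joint type of the words `x` and `y`. -/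
def jointCount {n : ℕ} (x : Fin n → X) (y : Fin n → Y) (z : X × Y) : ℕ :=
  (Finset.univ.filter fun i => (x i, y i) = z).card

open Classical in
/-- The decoder that anticipates the single joint type `τ / n`: it chooses uniformly among the
messages whose codeword has this joint type with the received word `y` and whose cloud contains
`y` at least once, whatever the number of replicas of `y`. -/
def typeDecoder {n M N : ℕ} (τ : X × Y → ℕ) : Decoder X Y n M N := fun C c y =>
  uniformChoice (Finset.univ.filter fun m => jointCount (C m) y = τ ∧ ∃ j, c m j = y)

/-- `P_e(C)`: the average error probability of maximum-likelihood decoding with clouds of size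
`⌊e^{nK}⌋`. -/
def Pe {n M : ℕ} (W : X → Y → ℝ) (K : ℝ) (C : Codebook X n M) : ℝ :=
  errProb W (mlDecoder X Y n M (expSize n K)) C

/-- The error probability of maximum-likelihood decoding averaged also over i.i.d. random
codebooks of `⌊e^{nR}⌋` codewords. -/
def PeRandom (W : X → Y → ℝ) (R K : ℝ) (P : X → ℝ) (n : ℕ) : ℝ :=
  avgErrProb W (mlDecoder X Y n (expSize n R) (expSize n K)) P

/-- The same average for the decoder that anticipates the joint type `τ / n`. -/
def PeRandomType (W : X → Y → ℝ) (R K : ℝ) (P : X → ℝ) (n : ℕ) (τ : X × Y → ℕ) : ℝ :=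
  avgErrProb W (typeDecoder τ : Decoder X Y n (expSize n R) (expSize n K)) P

/-- `-(1/n) log p`. -/
def expo (n : ℕ) (p : ℝ) : ℝ := -(1 / (n : ℝ)) * Real.log p

end

/-!
Both exponents are minima over joint laws `Q` on `X × Y`. With the support of `Q` inside that of
`P(x) W(y|x)`, the objective of `E_c(P, R, K)` is a continuous real function of `Q`; it exceeds the
objective of `E_c(R, K)` by a divergence between first marginals, which yields
`E_c(R, K) = min_P E_c(P, R, K)`.

Converse: given the received word `y`, the probability of a correct decision is at most the maximum
over the messages of the number of replicas of `y` in their clouds, divided by the normalization.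
Split the messages according to the joint type of their codeword with `y`. For each of the
polynomially many types, an exponential moment bounds the expected maximum up to a factor linear in
`n`, and counting the words of that joint type turns the bound into the exponent of `E_c(R, K)`.

Achievability: aim at the joint type `τ_n` of a single pair of words that is typical under a
minimizer `Q` of `E_c(P, R, K)`. The tangent to `z ↦ 1 / z` makes the random choice among the
candidates linear in the competing messages. If `μ` bounds the expected number of those, the
probability of correct decoding is therefore at least that of the type class divided by `1 + μ`.
-/

noncomputable section

open Finset Function Real

theorem ereal_coe_sum {α : Type*} (s : Finset α) (f : α → ℝ) :
    ((∑ a ∈ s, f a : ℝ) : EReal) = ∑ a ∈ s, (f a : EReal) :=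
  map_sum (⟨⟨Real.toEReal, EReal.coe_zero⟩, EReal.coe_add⟩ : ℝ →+ EReal) f s

theorem ereal_sum_eq_top {α : Type*} [Fintype α] {f : α → EReal} (h : ∀ a, f a ≠ ⊥) {a : α}
    (ha : f a = ⊤) : ∑ a, f a = ⊤ := by
  classical
  have sum_ne_bot (s : Finset α) : ∑ a ∈ s, f a ≠ ⊥ :=
    sum_induction f (· ≠ ⊥) (fun _ _ hx hy ↦ EReal.add_ne_bot_iff.2 ⟨hx, hy⟩)
      EReal.zero_ne_bot fun a _ ↦ h a
  rw [← add_sum_erase univ f (mem_univ a), ha, EReal.top_add_of_ne_bot (sum_ne_bot _)]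

/-- The expectation `E_p[log f]`; in particular `expLog p p` is minus the entropy of `p`. -/
def expLog {α : Type*} [Fintype α] (f p : α → ℝ) : ℝ := ∑ a, p a * log (f a)

/-- The image of the distribution `Q` under `g`; `Prod.fst` and `Prod.snd` give the marginals of a
joint distribution. -/
def marginal {α β : Type*} [Finite α] [Finite β] (g : α → β) (Q : α → ℝ) : β → ℝ :=
  FunOnFinite.linearMap ℝ ℝ g Q

section Marginal

variable {α β : Type*} [Finite α] [Finite β]

theorem marginal_apply [Fintype α] [DecidableEq β] (g : α → β) (Q : α → ℝ) (b : β) :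
    marginal g Q b = ∑ a with g a = b, Q a :=
  FunOnFinite.linearMap_apply_apply ..

theorem marginal_fst [Fintype β] (Q : α × β → ℝ) (a : α) :
    marginal Prod.fst Q a = ∑ b, Q (a, b) := by
  classical
  have := Fintype.ofFinite α
  rw [marginal_apply, sum_filter, Fintype.sum_prod_type, Fintype.sum_eq_single a (by simp_all)]
  simp only [if_true]

theorem marginal_snd [Fintype α] (Q : α × β → ℝ) (b : β) :
    marginal Prod.snd Q b = ∑ a, Q (a, b) := by
  classical
  have := Fintype.ofFinite β
  rw [marginal_apply, sum_filter, Fintype.sum_prod_type_right,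
    Fintype.sum_eq_single b (by simp_all)]
  simp only [if_true]

theorem marginal_nonneg (g : α → β) {Q : α → ℝ} (hQ : 0 ≤ Q) : 0 ≤ marginal g Q := fun b ↦ by
  classical
  have := Fintype.ofFinite α
  rw [marginal_apply]
  exact sum_nonneg fun a _ ↦ hQ a

theorem sum_comp_le_marginal {γ : Type*} [Fintype γ] (g : α → β) {Q : α → ℝ} (hQ : 0 ≤ Q)
    {φ : γ → α} (hφ : Injective φ) {b : β} (hb : ∀ c, g (φ c) = b) :
    ∑ c, Q (φ c) ≤ marginal g Q b := by
  classical
  have := Fintype.ofFinite α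
  rw [marginal_apply]
  refine (sum_map univ ⟨φ, hφ⟩ Q).symm.trans_le
    (sum_le_sum_of_subset_of_nonneg (fun a ha ↦ ?_) fun a _ _ ↦ hQ a)
  obtain ⟨c, -, rfl⟩ := mem_map.1 ha
  exact mem_filter.2 ⟨mem_univ _, hb c⟩

theorem marginal_pos (g : α → β) {Q : α → ℝ} (hQ : 0 ≤ Q) {a : α} (ha : Q a ≠ 0) :
    0 < marginal g Q (g a) := by
  classical
  have := Fintype.ofFinite α
  rw [marginal_apply]
  exact sum_pos' (fun a _ ↦ hQ a) ⟨a, by simp, (hQ a).lt_of_ne' ha⟩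

theorem support_subset_support_marginal_comp (g : α → β) {Q : α → ℝ} (hQ : 0 ≤ Q) :
    support Q ⊆ support (marginal g Q ∘ g) :=
  fun _ ha ↦ (marginal_pos g hQ ha).ne'

theorem continuous_marginal (g : α → β) : Continuous (marginal g) :=
  FunOnFinite.continuous_linearMap ℝ ℝ g

end Marginal

section ExpLog

variable {α β : Type*} [Fintype α] [Fintype β]

theorem continuous_expLog (f : α → ℝ) : Continuous (expLog f) := by
  unfold expLog
  fun_prop

theorem continuous_expLog_self : Continuous fun p : α → ℝ ↦ expLog p p :=
  continuous_finsetSum _ fun a _ ↦ continuous_mul_log.comp (continuous_apply a)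

theorem expLog_mul {f g p : α → ℝ} (hf : support p ⊆ support f) (hg : support p ⊆ support g) :
    expLog (fun a ↦ f a * g a) p = expLog f p + expLog g p := by
  simp only [expLog, ← sum_add_distrib, ← mul_add]
  refine sum_congr rfl fun a _ ↦ ?_
  rcases eq_or_ne (p a) 0 with hp | hp
  · simp only [hp, zero_mul]
  · rw [log_mul (hf hp) (hg hp)]

theorem marginal_mem_stdSimplex (g : α → β) {Q : α → ℝ} (hQ : Q ∈ stdSimplex ℝ α) :
    marginal g Q ∈ stdSimplex ℝ β :=
  stdSimplex.image_linearMap g ⟨Q, hQ, rfl⟩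

theorem expLog_comp (g : α → β) (f : β → ℝ) (Q : α → ℝ) :
    expLog (f ∘ g) Q = expLog f (marginal g Q) := by
  classical
  simp only [expLog, marginal_apply, sum_mul]
  rw [← sum_fiberwise univ g]
  refine sum_congr rfl fun b _ ↦ sum_congr rfl fun a ha ↦ ?_
  rw [comp_apply, (mem_filter.1 ha).2]

theorem sum_sq_sqrt_sub_le {p q : α → ℝ} (hp : p ∈ stdSimplex ℝ α) (hq : q ∈ stdSimplex ℝ α)
    (hpq : support p ⊆ support q) :
    ∑ a, (√(p a) - √(q a)) ^ 2 ≤ expLog p p - expLog q p := by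
  have term_le (a : α) : (√(p a) - √(q a)) ^ 2 + (p a - q a) ≤
      p a * log (p a) - p a * log (q a) := by
    rcases (hp.1 a).eq_or_lt with h0 | h0
    · simp [← h0, sq_sqrt (hq.1 a)]
    have hq0 : 0 < q a := (hq.1 a).lt_of_ne' (hpq h0.ne')
    have hlog : log (√(q a) / √(p a)) ≤ √(q a) / √(p a) - 1 :=
      log_le_sub_one_of_pos (by positivity)
    rw [log_div (by positivity) (by positivity), log_sqrt hq0.le, log_sqrt h0.le] at hlog
    have hdiv : p a * (√(q a) / √(p a)) = √(p a) * √(q a) := by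
      nth_rewrite 1 [← mul_self_sqrt h0.le]
      field_simp
    nlinarith [mul_le_mul_of_nonneg_left hlog h0.le, sq_sqrt h0.le, sq_sqrt hq0.le]
  calc ∑ a, (√(p a) - √(q a)) ^ 2
      = ∑ a, ((√(p a) - √(q a)) ^ 2 + (p a - q a)) := by
        rw [sum_add_distrib, sum_sub_distrib, hp.2, hq.2, sub_self, add_zero]
    _ ≤ ∑ a, (p a * log (p a) - p a * log (q a)) := sum_le_sum fun a _ ↦ term_le a
    _ = expLog p p - expLog q p := sum_sub_distrib ..

theorem expLog_le_expLog_self {p q : α → ℝ} (hp : p ∈ stdSimplex ℝ α)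
    (hq : q ∈ stdSimplex ℝ α) (hpq : support p ⊆ support q) : expLog q p ≤ expLog p p :=
  sub_nonneg.1 <| (sum_nonneg fun _ _ ↦ sq_nonneg _).trans (sum_sq_sqrt_sub_le hp hq hpq)

end ExpLog

section Divergence

variable {α β : Type*} [Fintype α] [Fintype β]

theorem klTerm_ne_bot (p q : ℝ) : klTerm p q ≠ ⊥ := by
  unfold klTerm
  split_ifs
  exacts [EReal.zero_ne_bot, top_ne_bot, EReal.coe_ne_bot _]

theorem klTerm_eq_coe {p q : ℝ} (h : p ≠ 0 → q ≠ 0) :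
    klTerm p q = ((p * log p - p * log q : ℝ) : EReal) := by
  unfold klTerm
  split_ifs with hp hq
  · simp [hp]
  · exact absurd hq (h hp)
  · rw [log_div hp hq, mul_sub]

theorem relEnt_eq_coe {p q : α → ℝ} (h : support p ⊆ support q) :
    relEnt p q = ((expLog p p - expLog q p : ℝ) : EReal) := by
  rw [expLog, expLog, ← sum_sub_distrib, ereal_coe_sum]
  exact sum_congr rfl fun a _ ↦ klTerm_eq_coe fun hp ↦ h hp

theorem relEnt_eq_top {p q : α → ℝ} (h : ¬support p ⊆ support q) : relEnt p q = ⊤ := by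
  obtain ⟨a, hp, hq⟩ := Set.not_subset.1 h
  exact ereal_sum_eq_top (fun a ↦ klTerm_ne_bot _ _)
    (a := a) (by rw [klTerm, if_neg hp, if_pos (notMem_support.1 hq)])

theorem relEnt_const_mul {t : ℝ} (ht : 0 ≤ t) (p q : α → ℝ) :
    relEnt (fun a ↦ t * p a) (fun a ↦ t * q a) = t * relEnt p q := by
  rcases ht.eq_or_lt with rfl | ht
  · simp [relEnt, klTerm]
  have support_mul (f : α → ℝ) : support (fun a ↦ t * f a) = support f := by
    ext; simp [ht.ne']
  by_cases h : support p ⊆ support q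
  · rw [relEnt_eq_coe h, relEnt_eq_coe (by rwa [support_mul, support_mul]), ← EReal.coe_mul]
    simp only [expLog, ← sum_sub_distrib, mul_sum]
    congr 1
    refine sum_congr rfl fun a _ ↦ ?_
    rcases eq_or_ne (p a) 0 with hp | hp
    · simp [hp]
    · rw [log_mul ht.ne' hp, log_mul ht.ne' (h hp)]
      ring
  · rw [relEnt_eq_top h, relEnt_eq_top (by rwa [support_mul, support_mul]),
      EReal.coe_mul_top_of_pos ht]

theorem condRelEnt_eq_relEnt {T : α → ℝ} (hT : 0 ≤ T) (V Q : α → β → ℝ) :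
    condRelEnt T V Q = relEnt (jointXY T V) (jointXY T Q) := by
  rw [relEnt, Fintype.sum_prod_type]
  exact sum_congr rfl fun a _ ↦ (relEnt_const_mul (hT a) _ _).symm

theorem relEnt_comp_equiv (e : α ≃ β) (p q : β → ℝ) : relEnt (p ∘ e) (q ∘ e) = relEnt p q :=
  e.sum_comp fun b ↦ klTerm (p b) (q b)

theorem crossEnt_eq_coe {W : α → β → ℝ} {Q : α × β → ℝ} (h : support Q ⊆ support (uncurry W)) :
    crossEnt W Q = ((-expLog (uncurry W) Q : ℝ) : EReal) := by
  rw [expLog, ← sum_neg_distrib, ereal_coe_sum]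
  refine sum_congr rfl fun z _ ↦ ?_
  rcases eq_or_ne (Q z) 0 with hz | hz
  · simp [hz]
  · rw [negLog, if_neg (show W z.1 z.2 ≠ 0 from h hz), ← EReal.coe_mul, mul_neg, uncurry]

end Divergence

section Disintegration

theorem marginal_fst_jointXY {α β : Type*} [Finite α] [Fintype β] (P : α → ℝ)
    {U : α → β → ℝ} (hU : IsKernel U) :
    marginal Prod.fst (jointXY P U) = P := by
  ext a
  simp only [marginal_fst, jointXY, ← mul_sum, (hU a).2, mul_one]

theorem marginal_snd_jointYX {α β : Type*} [Fintype α] [Finite β] (T : β → ℝ)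
    {V : β → α → ℝ} (hV : IsKernel V) :
    marginal Prod.snd (jointYX T V) = T := by
  ext b
  simp only [marginal_snd, jointYX, ← mul_sum, (hV b).2, mul_one]

theorem marginal_fst_comp_swap {α β : Type*} [Finite α] [Finite β]
    (Q : α × β → ℝ) :
    marginal Prod.fst (Q ∘ Prod.swap) = marginal Prod.snd Q := by
  have := Fintype.ofFinite α
  ext b
  simp only [marginal_fst, marginal_snd, comp_apply, Prod.swap_prod_mk]

variable {α β : Type*} [Fintype α] [Fintype β]

theorem jointXY_mem_stdSimplex {P : α → ℝ} (hP : P ∈ stdSimplex ℝ α) {U : α → β → ℝ}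
    (hU : IsKernel U) : jointXY P U ∈ stdSimplex ℝ (α × β) := by
  refine ⟨fun z ↦ mul_nonneg (hP.1 _) ((hU _).1 _), ?_⟩
  simp only [jointXY, Fintype.sum_prod_type, ← mul_sum, (hU _).2, mul_one, hP.2]

theorem jointYX_mem_stdSimplex {T : β → ℝ} (hT : T ∈ stdSimplex ℝ β) {V : β → α → ℝ}
    (hV : IsKernel V) : jointYX T V ∈ stdSimplex ℝ (α × β) := by
  refine ⟨fun z ↦ mul_nonneg (hT.1 _) ((hV _).1 _), ?_⟩
  simp only [jointYX, Fintype.sum_prod_type_right, ← mul_sum, (hV _).2, mul_one, hT.2]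

theorem exists_jointXY_eq {Q : α × β → ℝ} (hQ : Q ∈ stdSimplex ℝ (α × β)) :
    ∃ U : α → β → ℝ, IsKernel U ∧ jointXY (marginal Prod.fst Q) U = Q := by
  classical
  set P := marginal Prod.fst Q with hP
  have P_nonneg : 0 ≤ P := (marginal_mem_stdSimplex _ hQ).1
  have Q_eq_zero {z : α × β} (hz : P z.1 = 0) : Q z = 0 :=
    by_contra fun h ↦ (marginal_pos Prod.fst hQ.1 h).ne' hz
  refine ⟨fun a b ↦ if P a = 0 then marginal Prod.snd Q b else Q (a, b) / P a, fun a ↦ ?_, ?_⟩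
  · by_cases ha : P a = 0
    · simpa only [ha, if_true] using marginal_mem_stdSimplex Prod.snd hQ
    · simp only [ha, if_false]
      refine ⟨fun b ↦ div_nonneg (hQ.1 _) (P_nonneg a), ?_⟩
      rw [← sum_div, ← marginal_fst, ← hP, div_self ha]
  · ext z
    by_cases hz : P z.1 = 0
    · simp only [jointXY, hz, zero_mul, Q_eq_zero hz]
    · simp only [jointXY, hz, if_false, Prod.mk.eta, mul_div_cancel₀ _ hz]

theorem exists_jointYX_eq {Q : α × β → ℝ} (hQ : Q ∈ stdSimplex ℝ (α × β)) :
    ∃ V : β → α → ℝ, IsKernel V ∧ jointYX (marginal Prod.snd Q) V = Q := by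
  have hQ_swap : Q ∘ Prod.swap ∈ stdSimplex ℝ (β × α) :=
    ⟨fun z ↦ hQ.1 _, ((Equiv.prodComm β α).sum_comp Q).trans hQ.2⟩
  obtain ⟨V, hV, hVQ⟩ := exists_jointXY_eq hQ_swap
  rw [marginal_fst_comp_swap] at hVQ
  exact ⟨V, hV, funext fun z ↦ congrFun hVQ z.swap⟩

end Disintegration

theorem support_jointXY {X Y : Type*} (P : X → ℝ) (W : X → Y → ℝ) :
    support (jointXY P W) = support (P ∘ Prod.fst) ∩ support (uncurry W) :=
  support_mul' _ _

theorem support_subset_jointXY_marginal_iff {X Y : Type*} [Finite X] [Finite Y]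
    {W : X → Y → ℝ} {Q : X × Y → ℝ} (hQ : 0 ≤ Q) :
    support Q ⊆ support (jointXY (marginal Prod.fst Q) W) ↔ support Q ⊆ support (uncurry W) := by
  rw [support_jointXY, Set.subset_inter_iff,
    and_iff_right (support_subset_support_marginal_comp Prod.fst hQ)]

section Exponent

variable {X Y : Type*} [Fintype X] [Fintype Y]

/-- The common form of the objectives of `E_c(R, K)`, where `P` is the first marginal of `Q`, and
of `E_c(P, R, K)`, where `P` is fixed. -/
def jointObjective (W : X → Y → ℝ) (P : X → ℝ) (R K : ℝ) (Q : X × Y → ℝ) : EReal :=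
  relEnt Q (jointXY P W) +
    max 0 ((R : EReal) - relEnt Q (jointXY P fun _ ↦ marginal Prod.snd Q) -
      max 0 (crossEnt W Q - (K : EReal)))

theorem EcObj_eq_jointObjective (W : X → Y → ℝ) (R K : ℝ) {P : X → ℝ} (hP : 0 ≤ P)
    {U : X → Y → ℝ} (hU : IsKernel U) :
    EcObj W R K P U =
      jointObjective W (marginal Prod.fst (jointXY P U)) R K (jointXY P U) := by
  simp only [EcObj, jointObjective, mutualInfo, ← marginal_fst, ← marginal_snd,
    marginal_fst_jointXY P hU, condRelEnt_eq_relEnt hP]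
  rfl

theorem EcPObj_eq_jointObjective (W : X → Y → ℝ) (P : X → ℝ) (R K : ℝ) {T : Y → ℝ} (hT : 0 ≤ T)
    {V : Y → X → ℝ} (hV : IsKernel V) :
    EcPObj W P R K T V = jointObjective W P R K (jointYX T V) := by
  have relEnt_swap : relEnt (jointXY T V) (jointXY T fun _ ↦ P) =
      relEnt (jointYX T V) (jointXY P fun _ ↦ T) := by
    rw [← relEnt_comp_equiv (Equiv.prodComm X Y)]
    exact congrArg _ (funext fun _ ↦ mul_comm _ _)
  rw [EcPObj, jointObjective, marginal_snd_jointYX T hV, condRelEnt_eq_relEnt hT, relEnt_swap]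

theorem Ec_eq_iInf (W : X → Y → ℝ) (R K : ℝ) :
    Ec W R K = ⨅ Q ∈ stdSimplex ℝ (X × Y), jointObjective W (marginal Prod.fst Q) R K Q := by
  apply le_antisymm
  · refine le_iInf₂ fun Q hQ ↦ ?_
    obtain ⟨U, hU, hUQ⟩ := exists_jointXY_eq hQ
    have hP := marginal_mem_stdSimplex Prod.fst hQ
    refine (iInf₂_le_of_le _ hP <| iInf₂_le U hU).trans_eq ?_
    rw [EcObj_eq_jointObjective W R K hP.1 hU, hUQ]
  · refine le_iInf₂ fun P hP ↦ le_iInf₂ fun U hU ↦ ?_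
    rw [EcObj_eq_jointObjective W R K hP.1 hU]
    exact iInf₂_le _ (jointXY_mem_stdSimplex hP hU)

theorem EcP_eq_iInf (W : X → Y → ℝ) (P : X → ℝ) (R K : ℝ) :
    EcP W P R K = ⨅ Q ∈ stdSimplex ℝ (X × Y), jointObjective W P R K Q := by
  apply le_antisymm
  · refine le_iInf₂ fun Q hQ ↦ ?_
    obtain ⟨V, hV, hVQ⟩ := exists_jointYX_eq hQ
    have hT := marginal_mem_stdSimplex Prod.snd hQ
    refine (iInf₂_le_of_le _ hT <| iInf₂_le V hV).trans_eq ?_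
    rw [EcPObj_eq_jointObjective W P R K hT.1 hV, hVQ]
  · refine le_iInf₂ fun T hT ↦ le_iInf₂ fun V hV ↦ ?_
    rw [EcPObj_eq_jointObjective W P R K hT.1 hV]
    exact iInf₂_le _ (jointYX_mem_stdSimplex hT hV)

/-- The exponent of words of joint type `t` when the single-letter likelihoods are those of `P`, of
`W` and of `Q`. At `t = Q` it is the real form of `jointObjective W P R K Q`, but for fixed `Q` it
is continuous in `t`, which allows `Q` to be approximated by types. -/
def decodingExponent (W : X → Y → ℝ) (P : X → ℝ) (R K : ℝ) (Q t : X × Y → ℝ) : ℝ :=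
  (expLog Q t - expLog (P ∘ Prod.fst) t - expLog (uncurry W) t) +
    max 0 (R - (expLog Q t - expLog (P ∘ Prod.fst) t - expLog (marginal Prod.snd Q ∘ Prod.snd) t) -
      max 0 (-expLog (uncurry W) t - K))

theorem continuous_decodingExponent (W : X → Y → ℝ) (P : X → ℝ) (R K : ℝ) (Q : X × Y → ℝ) :
    Continuous (decodingExponent W P R K Q) := by
  unfold decodingExponent
  have := @continuous_expLog (X × Y)
  fun_prop

theorem continuous_decodingExponent_self (W : X → Y → ℝ) (R K : ℝ) {p : (X × Y → ℝ) → X → ℝ}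
    (hp : Continuous fun Q ↦ expLog (p Q ∘ Prod.fst) Q) :
    Continuous fun Q ↦ decodingExponent W (p Q) R K Q Q := by
  have hQ := continuous_expLog_self (α := X × Y)
  have hT := continuous_expLog_self.comp (continuous_marginal (Prod.snd : X × Y → Y))
  have hW := continuous_expLog (uncurry W)
  simp only [decodingExponent, expLog_comp Prod.snd]
  exact ((hQ.sub hp).sub hW).add <| continuous_const.max <|
    (continuous_const.sub ((hQ.sub hp).sub hT)).sub <| continuous_const.max <|
      hW.neg.sub continuous_const

theorem jointObjective_eq_coe {W : X → Y → ℝ} {P : X → ℝ} (R K : ℝ) {Q : X × Y → ℝ} (hQ : 0 ≤ Q)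
    (h : support Q ⊆ support (jointXY P W)) :
    jointObjective W P R K Q = (decodingExponent W P R K Q Q : EReal) := by
  obtain ⟨hP, hW⟩ := Set.subset_inter_iff.1 (h.trans_eq (support_jointXY P W))
  have hT := support_subset_support_marginal_comp Prod.snd hQ
  have h' : support Q ⊆ support (jointXY P fun _ ↦ marginal Prod.snd Q) :=
    (Set.subset_inter hP hT).trans_eq (support_jointXY P fun _ ↦ marginal Prod.snd Q).symm
  rw [jointObjective, relEnt_eq_coe h, relEnt_eq_coe h', crossEnt_eq_coe hW, decodingExponent,
    show expLog (jointXY P W) Q = _ from expLog_mul hP hW,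
    show expLog (jointXY P fun _ ↦ marginal Prod.snd Q) Q = _ from expLog_mul hP hT,
    sub_add_eq_sub_sub, sub_add_eq_sub_sub]
  norm_cast

theorem jointObjective_eq_top {W : X → Y → ℝ} {P : X → ℝ} (R K : ℝ) {Q : X × Y → ℝ}
    (h : ¬support Q ⊆ support (jointXY P W)) : jointObjective W P R K Q = ⊤ := by
  rw [jointObjective, relEnt_eq_top h, EReal.top_add_of_ne_bot]
  exact (EReal.bot_lt_zero.trans_le (le_max_left _ _)).ne'

theorem exists_isMin_of_continuous_on_support {α : Type*} [Fintype α] {s : Set α}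
    (hs : ∃ p ∈ stdSimplex ℝ α, support p ⊆ s) {F : (α → ℝ) → EReal} {f : (α → ℝ) → ℝ}
    (hf : Continuous f) (hFf : ∀ p ∈ stdSimplex ℝ α, support p ⊆ s → F p = f p)
    (hF : ∀ p ∈ stdSimplex ℝ α, ¬support p ⊆ s → F p = ⊤) :
    ∃ p ∈ stdSimplex ℝ α, support p ⊆ s ∧ F p = ⨅ q ∈ stdSimplex ℝ α, F q := by
  have hclosed : IsClosed {p : α → ℝ | support p ⊆ s} := by
    simp only [support_subset_iff', Set.ofPred_forall]
    exact isClosed_iInter fun a ↦ isClosed_iInter fun _ ↦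
      isClosed_singleton.preimage (continuous_apply a)
  obtain ⟨p, ⟨hp, hps⟩, hmin⟩ := ((isCompact_stdSimplex ℝ α).inter_right hclosed).exists_isMinOn
    hs hf.continuousOn
  refine ⟨p, hp, hps, le_antisymm (le_iInf₂ fun q hq ↦ ?_) (iInf₂_le p hp)⟩
  by_cases hqs : support q ⊆ s
  · rw [hFf p hp hps, hFf q hq hqs]
    exact EReal.coe_le_coe (hmin ⟨hq, hqs⟩)
  · exact le_top.trans_eq (hF q hq hqs).symm

theorem exists_jointObjective_eq_EcP {W : X → Y → ℝ} (hW : IsKernel W) {P : X → ℝ}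
    (hP : P ∈ stdSimplex ℝ X) (R K : ℝ) :
    ∃ Q ∈ stdSimplex ℝ (X × Y), support Q ⊆ support (jointXY P W) ∧
      jointObjective W P R K Q = EcP W P R K := by
  rw [EcP_eq_iInf]
  exact exists_isMin_of_continuous_on_support ⟨_, jointXY_mem_stdSimplex hP hW, subset_rfl⟩
    (continuous_decodingExponent_self W R K (continuous_expLog _))
    (fun Q hQ h ↦ jointObjective_eq_coe R K hQ.1 h)
    fun Q _ h ↦ jointObjective_eq_top R K h

theorem exists_jointObjective_eq_Ec [Nonempty X] {W : X → Y → ℝ} (hW : IsKernel W) (R K : ℝ) :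
    ∃ Q ∈ stdSimplex ℝ (X × Y), jointObjective W (marginal Prod.fst Q) R K Q = Ec W R K := by
  classical
  obtain ⟨P, hP⟩ : (stdSimplex ℝ X).Nonempty :=
    ⟨_, single_mem_stdSimplex ℝ (Classical.arbitrary X)⟩
  have hPW : support (jointXY P W) ⊆ support (uncurry W) :=
    (support_jointXY P W).trans_subset Set.inter_subset_right
  have expLog_marginal :
      Continuous fun Q : X × Y → ℝ ↦ expLog (marginal Prod.fst Q ∘ Prod.fst) Q := by
    simp only [expLog_comp]
    exact continuous_expLog_self.comp (continuous_marginal Prod.fst)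
  rw [Ec_eq_iInf]
  obtain ⟨Q, hQ, -, hmin⟩ := exists_isMin_of_continuous_on_support
    ⟨_, jointXY_mem_stdSimplex hP hW, hPW⟩ (continuous_decodingExponent_self W R K expLog_marginal)
    (fun Q hQ h ↦ jointObjective_eq_coe R K hQ.1 <|
      (support_subset_jointXY_marginal_iff hQ.1).2 h)
    fun Q hQ h ↦ jointObjective_eq_top R K <|
      (support_subset_jointXY_marginal_iff hQ.1).not.2 h
  exact ⟨Q, hQ, hmin⟩

theorem exists_EcObj_eq_Ec [Nonempty X] {W : X → Y → ℝ} (hW : IsKernel W) (R K : ℝ) :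
    ∃ P ∈ stdSimplex ℝ X, ∃ U : X → Y → ℝ, IsKernel U ∧ EcObj W R K P U = Ec W R K := by
  obtain ⟨Q, hQ, hmin⟩ := exists_jointObjective_eq_Ec hW R K
  obtain ⟨U, hU, hUQ⟩ := exists_jointXY_eq hQ
  have hP := marginal_mem_stdSimplex Prod.fst hQ
  exact ⟨_, hP, U, hU, by rw [EcObj_eq_jointObjective W R K hP.1 hU, hUQ, hmin]⟩

theorem exists_EcPObj_eq_EcP {W : X → Y → ℝ} (hW : IsKernel W) {P : X → ℝ}
    (hP : P ∈ stdSimplex ℝ X) (R K : ℝ) :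
    ∃ T ∈ stdSimplex ℝ Y, ∃ V : Y → X → ℝ, IsKernel V ∧ EcPObj W P R K T V = EcP W P R K := by
  obtain ⟨Q, hQ, -, hmin⟩ := exists_jointObjective_eq_EcP hW hP R K
  obtain ⟨V, hV, hVQ⟩ := exists_jointYX_eq hQ
  have hT := marginal_mem_stdSimplex Prod.snd hQ
  exact ⟨_, hT, V, hV, by rw [EcPObj_eq_jointObjective W P R K hT.1 hV, hVQ, hmin]⟩

theorem decodingExponent_marginal_le (W : X → Y → ℝ) {P : X → ℝ} (hP : P ∈ stdSimplex ℝ X)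
    (R K : ℝ) {Q : X × Y → ℝ} (hQ : Q ∈ stdSimplex ℝ (X × Y))
    (h : support Q ⊆ support (P ∘ Prod.fst)) :
    decodingExponent W (marginal Prod.fst Q) R K Q Q ≤ decodingExponent W P R K Q Q := by
  have support_marginal : support (marginal Prod.fst Q) ⊆ support P := by
    intro x hx
    obtain ⟨y, -, hy⟩ := exists_ne_zero_of_sum_ne_zero ((marginal_fst Q x).symm.trans_ne hx)
    exact h hy
  have gibbs : expLog (P ∘ Prod.fst) Q ≤ expLog (marginal Prod.fst Q ∘ Prod.fst) Q := by
    rw [expLog_comp, expLog_comp]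
    exact expLog_le_expLog_self (marginal_mem_stdSimplex _ hQ) hP support_marginal
  unfold decodingExponent
  grind

theorem jointObjective_marginal_le (W : X → Y → ℝ) {P : X → ℝ} (hP : P ∈ stdSimplex ℝ X)
    (R K : ℝ) {Q : X × Y → ℝ} (hQ : Q ∈ stdSimplex ℝ (X × Y)) :
    jointObjective W (marginal Prod.fst Q) R K Q ≤ jointObjective W P R K Q := by
  by_cases h : support Q ⊆ support (jointXY P W)
  · obtain ⟨hQP, hQW⟩ := Set.subset_inter_iff.1 (h.trans_eq (support_jointXY P W))
    rw [jointObjective_eq_coe R K hQ.1 h,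
      jointObjective_eq_coe R K hQ.1 ((support_subset_jointXY_marginal_iff hQ.1).2 hQW)]
    exact EReal.coe_le_coe (decodingExponent_marginal_le W hP R K hQ hQP)
  · exact le_top.trans_eq (jointObjective_eq_top R K h).symm

theorem isLeast_EcP [Nonempty X] {W : X → Y → ℝ} (hW : IsKernel W) (R K : ℝ) :
    IsLeast ((fun P ↦ EcP W P R K) '' stdSimplex ℝ X) (Ec W R K) := by
  have Ec_le_EcP {P : X → ℝ} (hP : P ∈ stdSimplex ℝ X) : Ec W R K ≤ EcP W P R K := by
    rw [Ec_eq_iInf, EcP_eq_iInf]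
    exact iInf₂_mono fun Q hQ ↦ jointObjective_marginal_le W hP R K hQ
  refine ⟨?_, Set.forall_mem_image.2 fun P hP ↦ Ec_le_EcP hP⟩
  obtain ⟨Q, hQ, hmin⟩ := exists_jointObjective_eq_Ec hW R K
  have hP := marginal_mem_stdSimplex Prod.fst hQ
  refine ⟨_, hP, (Ec_le_EcP hP).antisymm' ?_⟩
  rw [← hmin, EcP_eq_iInf]
  exact iInf₂_le Q hQ

end Exponent

theorem sum_pi_prod_mul_prod {ι κ R : Type*} [Fintype ι] [DecidableEq ι] [Fintype κ]
    [CommSemiring R] {p : ι → κ → R} (hp : ∀ i, ∑ k, p i k = 1) (s : Finset ι) (g : ι → κ → R) :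
    ∑ f : ι → κ, (∏ i, p i (f i)) * ∏ i ∈ s, g i (f i) = ∏ i ∈ s, ∑ k, p i k * g i k := by
  have prod_univ (h : ι → R) : ∏ i ∈ s, h i = ∏ i, if i ∈ s then h i else 1 := by
    rw [prod_ite_mem, univ_inter]
  simp only [prod_univ, ← prod_mul_distrib]
  rw [← Fintype.prod_sum fun i k ↦ p i k * if i ∈ s then g i k else 1]
  refine prod_congr rfl fun i _ ↦ ?_
  split_ifs <;> simp only [mul_one, hp]

section Types

variable {α : Type*} {n : ℕ}

open Classical in
/-- `n` times the type of the word `w`: the number of occurrences of each letter. -/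
def letterCount (w : Fin n → α) (a : α) : ℕ := #{i | w i = a}

/-- The type (empirical distribution) of the word `w`. Types with denominator `n` are represented
by words that have them. -/
def empirical (w : Fin n → α) (a : α) : ℝ := letterCount w a / n

theorem jointCount_eq_letterCount {X Y : Type*} (x : Fin n → X) (y : Fin n → Y) :
    jointCount x y = letterCount fun i ↦ (x i, y i) := by
  unfold jointCount letterCount
  congr!

theorem empirical_nonneg (w : Fin n → α) : 0 ≤ empirical w := fun _ ↦ by
  unfold empirical
  positivity

theorem support_empirical_subset {f : α → ℝ} {w : Fin n → α} (hf : ∀ i, 0 < f (w i)) :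
    support (empirical w) ⊆ support f := by
  intro a ha
  have hcount : letterCount w a ≠ 0 := fun h ↦ ha (by simp [empirical, h])
  classical
  obtain ⟨i, hi⟩ := card_ne_zero.1 hcount
  exact (mem_filter.1 hi).2 ▸ (hf i).ne'

theorem empirical_pos (w : Fin n → α) (i : Fin n) : 0 < empirical w (w i) := by
  have hcount : 0 < letterCount w (w i) := card_pos.2 ⟨i, by simp⟩
  have hn := i.pos
  unfold empirical
  positivity

@[to_additive]
theorem prod_eq_prod_pow_letterCount [Fintype α] {M : Type*} [CommMonoid M] (f : α → M)
    (w : Fin n → α) :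
    ∏ i, f (w i) = ∏ a, f a ^ letterCount w a := by
  classical
  rw [← prod_fiberwise univ w]
  refine prod_congr rfl fun a _ ↦ ?_
  rw [prod_congr rfl fun i hi ↦ by rw [(mem_filter.1 hi).2], prod_const]
  unfold letterCount
  congr!

theorem prod_eq_prod_of_letterCount_eq [Finite α] {M : Type*} [CommMonoid M] (f : α → M)
    {v w : Fin n → α} (h : letterCount v = letterCount w) : ∏ i, f (v i) = ∏ i, f (w i) := by
  have := Fintype.ofFinite α
  rw [prod_eq_prod_pow_letterCount, h, ← prod_eq_prod_pow_letterCount]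

variable [Fintype α]

theorem sum_letterCount (w : Fin n → α) : ∑ a, letterCount w a = n := by
  simpa using (sum_eq_sum_nsmul_letterCount (fun _ ↦ (1 : ℕ)) w).symm

theorem empirical_mem_stdSimplex (hn : n ≠ 0) (w : Fin n → α) :
    empirical w ∈ stdSimplex ℝ α := by
  refine ⟨empirical_nonneg w, ?_⟩
  simp only [empirical, ← sum_div]
  rw [← Nat.cast_sum, sum_letterCount, div_self (Nat.cast_ne_zero.2 hn)]

theorem prod_eq_exp_expLog {f : α → ℝ} {w : Fin n → α} (hf : ∀ i, 0 < f (w i)) :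
    ∏ i, f (w i) = exp (n * expLog f (empirical w)) := by
  rcases eq_or_ne n 0 with rfl | hn
  · simp
  have hn' : (n : ℝ) ≠ 0 := Nat.cast_ne_zero.2 hn
  have mul_expLog : n * expLog f (empirical w) = ∑ i, log (f (w i)) := by
    rw [sum_eq_sum_nsmul_letterCount (fun a ↦ log (f a)), expLog, mul_sum]
    refine sum_congr rfl fun a _ ↦ ?_
    rw [nsmul_eq_mul, ← mul_assoc, empirical, mul_div_cancel₀ _ hn']
  rw [mul_expLog, exp_sum, prod_congr rfl fun i _ ↦ exp_log (hf i)]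

theorem card_filter_letterCount_mul_prod_le_one {β : Type*} [Fintype β] {φ : Fin n → β → α}
    {g : α → ℝ} (hg : 0 ≤ g) (hg_sum : ∀ i, ∑ b, g (φ i b) ≤ 1) (v : Fin n → α) :
    #{w : Fin n → β | letterCount (fun i ↦ φ i (w i)) = letterCount v} * ∏ i, g (v i) ≤ 1 := by
  classical
  calc #{w : Fin n → β | letterCount (fun i ↦ φ i (w i)) = letterCount v} * ∏ i, g (v i)
      = ∑ w : Fin n → β with letterCount (fun i ↦ φ i (w i)) = letterCount v,
          ∏ i, g (φ i (w i)) := by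
        rw [sum_congr rfl fun w hw ↦ prod_eq_prod_of_letterCount_eq g (mem_filter.1 hw).2,
          sum_const, nsmul_eq_mul]
    _ ≤ ∑ w : Fin n → β, ∏ i, g (φ i (w i)) :=
        sum_le_univ_sum_of_nonneg fun w ↦ prod_nonneg fun i _ ↦ hg _
    _ = ∏ i, ∑ b, g (φ i b) := (Fintype.prod_sum fun i b ↦ g (φ i b)).symm
    _ ≤ 1 := prod_le_one (fun i _ ↦ sum_nonneg fun b _ ↦ hg _) fun i _ ↦ hg_sum i

theorem exists_sum_le_mul_sum_letterCount_eq {ι : Type*} (s : Finset ι) (w : ι → Fin n → α)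
    {f : ι → ℝ} (hf : 0 < ∑ i ∈ s, f i) :
    ∃ j ∈ s, ∑ i ∈ s, f i ≤ ((n : ℝ) + 1) ^ Fintype.card α *
      ∑ i ∈ s with letterCount (w i) = letterCount (w j), f i := by
  classical
  set counts : Finset (α → ℕ) := Fintype.piFinset fun _ ↦ range (n + 1)
  have mem_counts (i : ι) : letterCount (w i) ∈ counts :=
    Fintype.mem_piFinset.2 fun a ↦ mem_range_succ_iff.2 <| (card_le_univ _).trans_eq (by simp)
  have card_counts : (#counts : ℝ) = ((n : ℝ) + 1) ^ Fintype.card α := by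
    simp [counts, Fintype.card_piFinset]
  obtain ⟨i₀, -⟩ := nonempty_of_sum_ne_zero hf.ne'
  obtain ⟨τ, -, hτ⟩ := exists_le_sum_fiber_of_maps_to_of_nsmul_le_sum
    (b := (∑ i ∈ s, f i) / #counts) (fun i (_ : i ∈ s) ↦ mem_counts i) ⟨_, mem_counts i₀⟩
    (by rw [nsmul_eq_mul, card_counts, mul_div_cancel₀ _ (by positivity)])
  rw [card_counts, div_le_iff₀' (by positivity)] at hτ
  obtain ⟨j, hj⟩ := nonempty_of_sum_ne_zero
    (pos_of_mul_pos_right (hf.trans_le hτ) (by positivity)).ne'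
  obtain ⟨hjs, rfl⟩ := mem_filter.1 hj
  exact ⟨j, hjs, hτ⟩

/-- The probability, under letters i.i.d. with law `q`, of the words that have the type of `v`. -/
def typeClassProb (q : α → ℝ) (v : Fin n → α) : ℝ :=
  ∑ w : Fin n → α with letterCount w = letterCount v, ∏ i, q (w i)

theorem typeClassProb_eq_mul_prod (q : α → ℝ) (v : Fin n → α) :
    typeClassProb q v = #{w : Fin n → α | letterCount w = letterCount v} * ∏ i, q (v i) := by
  rw [typeClassProb,
    sum_congr rfl fun w hw ↦ prod_eq_prod_of_letterCount_eq q (mem_filter.1 hw).2, sum_const,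
    nsmul_eq_mul]

theorem typeClassProb_le_one {q : α → ℝ} (hq : q ∈ stdSimplex ℝ α) (v : Fin n → α) :
    typeClassProb q v ≤ 1 := by
  rw [typeClassProb_eq_mul_prod]
  exact card_filter_letterCount_mul_prod_le_one (φ := fun _ ↦ id) hq.1 (fun _ ↦ hq.2.le) v

theorem typeClassProb_mul_prod (p q : α → ℝ) (v : Fin n → α) :
    typeClassProb p v * ∏ i, q (v i) = typeClassProb q v * ∏ i, p (v i) := by
  rw [typeClassProb_eq_mul_prod, typeClassProb_eq_mul_prod, mul_right_comm]

theorem exists_one_le_mul_typeClassProb (n : ℕ) {q : α → ℝ} (hq : q ∈ stdSimplex ℝ α) :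
    ∃ v : Fin n → α, (∀ i, 0 < q (v i)) ∧
      1 ≤ ((n : ℝ) + 1) ^ Fintype.card α * typeClassProb q v := by
  classical
  have sum_prod : ∑ w : Fin n → α, ∏ i, q (w i) = 1 := by
    rw [← Fintype.prod_sum fun _ : Fin n ↦ q, hq.2, prod_const_one]
  obtain ⟨v, -, hv⟩ := exists_sum_le_mul_sum_letterCount_eq univ id
    (sum_prod ▸ one_pos : 0 < ∑ w : Fin n → α, ∏ i, q (w i))
  rw [sum_prod] at hv
  refine ⟨v, fun i ↦ (hq.1 _).lt_of_ne' fun h ↦ ?_, hv⟩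
  have : typeClassProb q v = 0 := by
    rw [typeClassProb_eq_mul_prod, prod_eq_zero (mem_univ i) h, mul_zero]
  rw [typeClassProb] at this
  norm_num [id, this] at hv

theorem typeClassProb_le_exp {q : α → ℝ} (hn : n ≠ 0) {v : Fin n → α} (hv : ∀ i, 0 < q (v i)) :
    typeClassProb q v ≤
      exp (-(n * (expLog (empirical v) (empirical v) - expLog q (empirical v)))) := by
  have h := typeClassProb_mul_prod q (empirical v) v
  rw [prod_eq_exp_expLog (empirical_pos v), prod_eq_exp_expLog hv] at h
  calc typeClassProb q v
      = typeClassProb (empirical v) v *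
          exp (n * expLog q (empirical v) - n * expLog (empirical v) (empirical v)) := by
        rw [exp_sub, ← mul_div_assoc, ← h, mul_div_cancel_right₀ _ (exp_ne_zero _)]
    _ ≤ _ := by
        refine (mul_le_of_le_one_left (exp_pos _).le
          (typeClassProb_le_one (empirical_mem_stdSimplex hn v) v)).trans_eq ?_
        congr 1
        ring

theorem tendsto_log_div (a b : ℝ) :
    Tendsto (fun n : ℕ ↦ (a * log ((n : ℝ) + 1) + b) / n) atTop (𝓝 0) := by
  have hlog : Tendsto (fun n : ℕ ↦ log ((n : ℝ) + 1) / n) atTop (𝓝 0) := by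
    have := (tendsto_pow_log_div_mul_add_atTop 1 (-1) 1 one_ne_zero).comp
      (tendsto_atTop_add_const_right atTop (1 : ℝ) tendsto_natCast_atTop_atTop)
    exact this.congr fun n ↦ by simp
  simpa only [mul_zero, add_zero, add_div, mul_div_assoc] using
    (hlog.const_mul a).add (tendsto_const_div_atTop_nhds_zero_nat b)

theorem natCast_add_one_pow_eq_exp (n k : ℕ) :
    ((n : ℝ) + 1) ^ k = exp (k * log ((n : ℝ) + 1)) := by
  rw [exp_nat_mul, exp_log (by positivity)]

theorem tendsto_empirical {q : α → ℝ} (hq : q ∈ stdSimplex ℝ α) {k : ℕ} {v : ∀ n, Fin n → α}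
    (hv : ∀ n i, 0 < q (v n i)) (hge : ∀ n : ℕ, 1 ≤ ((n : ℝ) + 1) ^ k * typeClassProb q (v n)) :
    Tendsto (fun n ↦ empirical (v n)) atTop (𝓝 q) := by
  rw [tendsto_pi_nhds]
  intro a
  have hellinger_le : ∀ᶠ n : ℕ in atTop,
      (√(empirical (v n) a) - √(q a)) ^ 2 ≤ (k * log ((n : ℝ) + 1) + 0) / n := by
    filter_upwards [eventually_ne_atTop 0] with n hn
    have h_le := (hge n).trans (mul_le_mul_of_nonneg_left (typeClassProb_le_exp hn (hv n))
      (by positivity))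
    rw [natCast_add_one_pow_eq_exp, ← exp_add, one_le_exp_iff, ← sub_eq_add_neg, sub_nonneg] at h_le
    rw [add_zero, le_div_iff₀' (by positivity)]
    refine (mul_le_mul_of_nonneg_left ?_ n.cast_nonneg).trans h_le
    exact (single_le_sum (f := fun a ↦ (√(empirical (v n) a) - √(q a)) ^ 2)
      (fun _ _ ↦ sq_nonneg _) (mem_univ a)).trans <| sum_sq_sqrt_sub_le
        (empirical_mem_stdSimplex hn _) hq (support_empirical_subset (hv n))
  have abs_tendsto := (squeeze_zero' (.of_forall fun n ↦ sq_nonneg _) hellinger_le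
    (tendsto_log_div k 0)).sqrt
  simp only [sqrt_sq_eq_abs, sqrt_zero] at abs_tendsto
  have sqrt_tendsto : Tendsto (fun n ↦ √(empirical (v n) a)) atTop (𝓝 √(q a)) := by
    simpa using ((tendsto_zero_iff_abs_tendsto_zero _).2 abs_tendsto).add_const √(q a)
  simpa only [sq_sqrt (hq.1 a), sq_sqrt (empirical_nonneg _ a)] using sqrt_tendsto.pow 2

end Types

theorem prod_mem_stdSimplex {ι α : Type*} [Fintype ι] [DecidableEq ι] [Fintype α]
    {p : ι → α → ℝ} (hp : ∀ i, p i ∈ stdSimplex ℝ α) :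
    (fun f : ι → α ↦ ∏ i, p i (f i)) ∈ stdSimplex ℝ (ι → α) :=
  ⟨fun _ ↦ prod_nonneg fun i _ ↦ (hp i).1 _,
    by rw [← Fintype.prod_sum p, prod_congr rfl fun i _ ↦ (hp i).2, prod_const_one]⟩

section Replicas

variable {α : Type*} {N : ℕ}

theorem letterCount_eq_sum_ite [DecidableEq α] (w : Fin N → α) (a : α) :
    (letterCount w a : ℝ) = ∑ j, if w j = a then 1 else 0 := by
  rw [sum_boole, letterCount]
  congr!

theorem exists_eq_iff_letterCount_ne_zero {w : Fin N → α} {a : α} :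
    (∃ j, w j = a) ↔ letterCount w a ≠ 0 := by
  classical
  simp [letterCount, filter_eq_empty_iff]

variable [Fintype α] {p : α → ℝ}

theorem sum_prod_mul_letterCount (hp : p ∈ stdSimplex ℝ α) (a : α) :
    ∑ w : Fin N → α, (∏ j, p (w j)) * letterCount w a = N * p a := by
  classical
  have prob_apply_eq (j : Fin N) :
      ∑ w : Fin N → α, (∏ j, p (w j)) * (if w j = a then 1 else 0) = p a := by
    simpa using sum_pi_prod_mul_prod (fun _ ↦ hp.2) {j} fun _ b ↦ if b = a then 1 else 0
  simp only [letterCount_eq_sum_ite, mul_sum]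
  rw [sum_comm, sum_congr rfl fun j _ ↦ prob_apply_eq j, sum_const, card_univ, Fintype.card_fin,
    nsmul_eq_mul]

theorem sum_prod_mul_exp_letterCount_le (hp : p ∈ stdSimplex ℝ α) (a : α) :
    ∑ w : Fin N → α, (∏ j, p (w j)) * exp (letterCount w a) ≤ exp (2 * (N * p a)) := by
  classical
  have factor_le : ∑ b, p b * exp (if b = a then 1 else 0) ≤ exp (2 * p a) := by
    calc ∑ b, p b * exp (if b = a then 1 else 0)
        = ∑ b, (p b + if b = a then p b * (exp 1 - 1) else 0) := by
          refine sum_congr rfl fun b _ ↦ ?_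
          split_ifs
          · ring
          · rw [exp_zero, mul_one, add_zero]
      _ = p a * (exp 1 - 1) + 1 := by rw [sum_add_distrib, hp.2, sum_ite_eq' univ]; simp [add_comm]
      _ ≤ 2 * p a + 1 := by nlinarith [exp_one_lt_d9, hp.1 a]
      _ ≤ exp (2 * p a) := add_one_le_exp _
  simp only [letterCount_eq_sum_ite, exp_sum]
  rw [sum_pi_prod_mul_prod (fun _ ↦ hp.2) univ fun _ b ↦ exp (if b = a then 1 else 0), prod_const,
    card_univ, Fintype.card_fin, mul_left_comm, exp_nat_mul]
  exact pow_le_pow_left₀ (sum_nonneg fun b _ ↦ mul_nonneg (hp.1 b) (exp_pos _).le) factor_le N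

end Replicas

theorem expSize_pos (n : ℕ) {r : ℝ} (hr : 0 ≤ r) : 0 < expSize n r :=
  Nat.floor_pos.2 (one_le_exp (by positivity))

theorem expSize_le (n : ℕ) (r : ℝ) : (expSize n r : ℝ) ≤ exp (n * r) :=
  Nat.floor_le (exp_pos _).le

theorem inv_expSize_le (n : ℕ) {r : ℝ} (hr : 0 ≤ r) :
    (expSize n r : ℝ)⁻¹ ≤ 2 * exp (-(n * r)) := by
  have one_le : (1 : ℝ) ≤ expSize n r := Nat.one_le_cast.2 (expSize_pos n hr)
  have exp_lt : exp (n * r) < expSize n r + 1 := Nat.lt_floor_add_one _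
  rw [exp_neg, ← div_eq_mul_inv, ← one_div, div_le_div_iff₀ (by positivity) (exp_pos _)]
  linarith

section Channel

variable {X Y : Type*} {n M N : ℕ}

/-- The probability that the memoryless channel `W` turns the word `x` into the word `y`. -/
def wordProb (W : X → Y → ℝ) (x : Fin n → X) (y : Fin n → Y) : ℝ := ∏ i, W (x i) (y i)

theorem instanceProb_eq_prod_wordProb (W : X → Y → ℝ) (C : Codebook X n M) (c : Clouds Y n M N) :
    instanceProb W C c = ∏ m, ∏ j, wordProb W (C m) (c m j) := rfl

/-- The values `φ C c y` of a decoder are subprobabilities on the messages. -/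
structure IsDecoder (φ : Decoder X Y n M N) : Prop where
  nonneg : ∀ C c y m, 0 ≤ φ C c y m
  sum_le_one : ∀ C c y, ∑ m, φ C c y m ≤ 1

theorem IsDecoder.le_one {φ : Decoder X Y n M N} (hφ : IsDecoder φ) (C : Codebook X n M)
    (c : Clouds Y n M N) (y : Fin n → Y) (m : Fin M) : φ C c y m ≤ 1 :=
  (single_le_sum (fun m _ ↦ hφ.nonneg C c y m) (mem_univ m)).trans (hφ.sum_le_one C c y)

variable [Fintype Y] {W : X → Y → ℝ}

theorem wordProb_mem_stdSimplex (hW : IsKernel W) (x : Fin n → X) :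
    wordProb W x ∈ stdSimplex ℝ (Fin n → Y) :=
  prod_mem_stdSimplex fun i ↦ hW (x i)

theorem cloudProb_mem_stdSimplex (hW : IsKernel W) (x : Fin n → X) :
    (fun c : Fin N → Fin n → Y ↦ ∏ j, wordProb W x (c j)) ∈ stdSimplex ℝ (Fin N → Fin n → Y) :=
  prod_mem_stdSimplex fun _ ↦ wordProb_mem_stdSimplex hW x

theorem instanceProb_mem_stdSimplex (hW : IsKernel W) (C : Codebook X n M) :
    instanceProb W C ∈ stdSimplex ℝ (Clouds Y n M N) :=
  prod_mem_stdSimplex fun m ↦ cloudProb_mem_stdSimplex hW (C m)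

theorem sum_instanceProb_mul_apply (hW : IsKernel W) (C : Codebook X n M) (m : Fin M)
    (f : (Fin N → Fin n → Y) → ℝ) :
    ∑ c : Clouds Y n M N, instanceProb W C c * f (c m) =
      ∑ c : Fin N → Fin n → Y, (∏ j, wordProb W (C m) (c j)) * f c := by
  simpa only [prod_singleton, instanceProb_eq_prod_wordProb] using
    sum_pi_prod_mul_prod (fun m ↦ (cloudProb_mem_stdSimplex hW (C m)).2) {m} fun _ ↦ f

/-- The expected number of members of the cloud of the message `m` that equal `y` and that the
decoder `φ` decodes correctly. -/
def correctCount (W : X → Y → ℝ) (φ : Decoder X Y n M N) (C : Codebook X n M) (y : Fin n → Y)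
    (m : Fin M) : ℝ :=
  ∑ c : Clouds Y n M N, instanceProb W C c * (letterCount (c m) y * φ C c y m)

theorem one_sub_errProb (hM : M ≠ 0) (hN : N ≠ 0) (hW : IsKernel W) (φ : Decoder X Y n M N)
    (C : Codebook X n M) :
    1 - errProb W φ C = (M * N : ℝ)⁻¹ * ∑ y, ∑ m, correctCount W φ C y m := by
  have sum_cloud (c : Clouds Y n M N) (m : Fin M) :
      ∑ j, (1 - φ C c (c m j) m) = N - ∑ y, letterCount (c m) y * φ C c y m := by
    rw [sum_sub_distrib, sum_eq_sum_nsmul_letterCount fun y ↦ φ C c y m]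
    simp only [sum_const, card_univ, Fintype.card_fin, nsmul_eq_mul, mul_one]
  have error_given (c : Clouds Y n M N) :
      1 / (M : ℝ) * ∑ m, 1 / (N : ℝ) * ∑ j, (1 - φ C c (c m j) m) =
        1 - (M * N : ℝ)⁻¹ * ∑ y, ∑ m, letterCount (c m) y * φ C c y m := by
    rw [sum_comm (γ := Fin n → Y)]
    simp only [sum_cloud, mul_sub, sum_sub_distrib, sum_const, card_univ, Fintype.card_fin,
      nsmul_eq_mul, ← mul_sum]
    field_simp
  calc 1 - errProb W φ C
      = 1 - ∑ c, instanceProb W C c *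
          (1 - (M * N : ℝ)⁻¹ * ∑ y, ∑ m, letterCount (c m) y * φ C c y m) := by
        simp_rw [errProb, error_given]
    _ = (M * N : ℝ)⁻¹ * ∑ c, instanceProb W C c * ∑ y, ∑ m, letterCount (c m) y * φ C c y m := by
        simp only [mul_sub, mul_one, sum_sub_distrib, (instanceProb_mem_stdSimplex hW C).2,
          sub_sub_cancel, mul_left_comm _ (M * N : ℝ)⁻¹, ← mul_sum]
    _ = (M * N : ℝ)⁻¹ * ∑ y, ∑ m, correctCount W φ C y m := by
        simp only [correctCount, mul_sum]
        rw [sum_comm, sum_congr rfl fun y _ ↦ sum_comm]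

theorem correctCount_nonneg (hW : IsKernel W) {φ : Decoder X Y n M N} (hφ : IsDecoder φ)
    (C : Codebook X n M) (y : Fin n → Y) (m : Fin M) : 0 ≤ correctCount W φ C y m :=
  sum_nonneg fun c _ ↦ mul_nonneg ((instanceProb_mem_stdSimplex hW C).1 c)
    (mul_nonneg (Nat.cast_nonneg _) (hφ.nonneg C c y m))

theorem correctCount_le_mul_wordProb (hW : IsKernel W) {φ : Decoder X Y n M N} (hφ : IsDecoder φ)
    (C : Codebook X n M) (y : Fin n → Y) (m : Fin M) :
    correctCount W φ C y m ≤ N * wordProb W (C m) y := by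
  rw [← sum_prod_mul_letterCount (wordProb_mem_stdSimplex hW (C m)),
    ← sum_instanceProb_mul_apply hW C m fun c ↦ (letterCount c y : ℝ)]
  exact sum_le_sum fun c _ ↦ mul_le_mul_of_nonneg_left
    (mul_le_of_le_one_right (Nat.cast_nonneg _) (hφ.le_one C c y m))
    ((instanceProb_mem_stdSimplex hW C).1 c)

/- The decoder can be correct for only one message, so the sum is at most the expected maximum of
the numbers of replicas; as `r ≤ a + exp (r - a)`, an exponential moment bounds it. -/
theorem sum_correctCount_le (hW : IsKernel W) {φ : Decoder X Y n M N} (hφ : IsDecoder φ)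
    (C : Codebook X n M) (y : Fin n → Y) (s : Finset (Fin M)) {a : ℝ} (ha : 0 ≤ a) :
    ∑ m ∈ s, correctCount W φ C y m ≤ a + ∑ m ∈ s, exp (2 * (N * wordProb W (C m) y) - a) := by
  have prob_nonneg (c : Clouds Y n M N) := (instanceProb_mem_stdSimplex hW C).1 c
  have pointwise (c : Clouds Y n M N) : ∑ m ∈ s, letterCount (c m) y * φ C c y m ≤
      a + ∑ m ∈ s, exp (letterCount (c m) y) * exp (-a) := by
    calc ∑ m ∈ s, letterCount (c m) y * φ C c y m
        ≤ ∑ m ∈ s, (a * φ C c y m + exp (letterCount (c m) y) * exp (-a)) := by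
          refine sum_le_sum fun m _ ↦ ?_
          rw [← exp_add, ← sub_eq_add_neg]
          nlinarith [hφ.nonneg C c y m, hφ.le_one C c y m, exp_pos (letterCount (c m) y - a),
            add_one_le_exp (letterCount (c m) y - a)]
      _ = a * ∑ m ∈ s, φ C c y m + ∑ m ∈ s, exp (letterCount (c m) y) * exp (-a) := by
          rw [sum_add_distrib, mul_sum]
      _ ≤ a + ∑ m ∈ s, exp (letterCount (c m) y) * exp (-a) := by
          gcongr
          exact mul_le_of_le_one_right ha
            ((sum_le_univ_sum_of_nonneg (hφ.nonneg C c y)).trans (hφ.sum_le_one C c y))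
  calc ∑ m ∈ s, correctCount W φ C y m
      = ∑ c, instanceProb W C c * ∑ m ∈ s, letterCount (c m) y * φ C c y m := by
        simp only [correctCount, mul_sum]
        exact sum_comm
    _ ≤ ∑ c, instanceProb W C c * (a + ∑ m ∈ s, exp (letterCount (c m) y) * exp (-a)) :=
        sum_le_sum fun c _ ↦ mul_le_mul_of_nonneg_left (pointwise c) (prob_nonneg c)
    _ = a + ∑ m ∈ s, (∑ c, instanceProb W C c * exp (letterCount (c m) y)) * exp (-a) := by
        simp only [mul_add, sum_add_distrib, ← sum_mul, (instanceProb_mem_stdSimplex hW C).2,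
          one_mul, mul_sum, ← mul_assoc, add_right_inj]
        rw [sum_comm]
    _ ≤ a + ∑ m ∈ s, exp (2 * (N * wordProb W (C m) y) - a) := by
        gcongr with m
        rw [sub_eq_add_neg, exp_add,
          sum_instanceProb_mul_apply hW C m fun c ↦ exp (letterCount c y)]
        gcongr
        exact sum_prod_mul_exp_letterCount_le (wordProb_mem_stdSimplex hW (C m)) y

end Channel

theorem card_filter_letterCount_le_exp {α β γ : Type*} [Fintype α] [Fintype β] [Finite γ]
    {n : ℕ} (g : α → γ) {φ : Fin n → β → α} (hφ : ∀ i, Injective (φ i))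
    (hg : ∀ i b b', g (φ i b) = g (φ i b')) {q : α → ℝ} (hq : 0 ≤ q) {v : Fin n → α}
    (hv : ∀ i, 0 < q (v i)) :
    #{w : Fin n → β | letterCount (fun i ↦ φ i (w i)) = letterCount v} ≤
      exp (-(n * (expLog q (empirical v) - expLog (marginal g q ∘ g) (empirical v)))) := by
  classical
  have fibre_le_one (i : Fin n) : ∑ b, q (φ i b) / (marginal g q ∘ g) (φ i b) ≤ 1 := by
    rcases isEmpty_or_nonempty β with _ | ⟨⟨b₀⟩⟩
    · simp
    rw [sum_congr rfl fun b _ ↦ by rw [comp_apply, hg i b b₀], ← sum_div]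
    exact div_le_one_of_le₀ (sum_comp_le_marginal g hq (hφ i) fun b ↦ hg i b b₀)
      (marginal_nonneg g hq _)
  have count_le := card_filter_letterCount_mul_prod_le_one
    (g := fun a ↦ q a / (marginal g q ∘ g) a)
    (fun a ↦ div_nonneg (hq a) (marginal_nonneg g hq _)) fibre_le_one v
  rwa [prod_div_distrib, prod_eq_exp_expLog hv,
    prod_eq_exp_expLog (f := marginal g q ∘ g) fun i ↦ marginal_pos g hq (hv i).ne', ← exp_sub,
    ← mul_sub, ← le_div_iff₀ (exp_pos _), one_div, ← exp_neg] at count_le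

section Converse

variable {X Y : Type*} {n M N : ℕ} {W : X → Y → ℝ}

theorem wordProb_eq_prod_of_jointCount_eq [Finite X] [Finite Y] {v : Fin n → X × Y} {x : Fin n → X}
    {y : Fin n → Y} (h : jointCount x y = letterCount v) :
    wordProb W x y = ∏ i, uncurry W (v i) :=
  prod_eq_prod_of_letterCount_eq (uncurry W) (v := fun i ↦ (x i, y i))
    (jointCount_eq_letterCount x y ▸ h)

variable [Fintype X] [Fintype Y]

/-- The part of the expected number of correctly decoded members of all clouds that is due to the
codewords and received words having the joint type of `v`. -/
def correctCountOfType (W : X → Y → ℝ) (φ : Decoder X Y n M N) (C : Codebook X n M)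
    (v : Fin n → X × Y) : ℝ :=
  ∑ y, ∑ m with jointCount (C m) y = letterCount v, correctCount W φ C y m

variable {φ : Decoder X Y n M N} {C : Codebook X n M} {v : Fin n → X × Y}

theorem exists_sum_correctCount_le (hW : IsKernel W) (hφ : IsDecoder φ)
    (hpos : 0 < ∑ y, ∑ m, correctCount W φ C y m) :
    ∃ v : Fin n → X × Y, (∀ i, 0 < uncurry W (v i)) ∧ ∑ y, ∑ m, correctCount W φ C y m ≤
      ((n : ℝ) + 1) ^ Fintype.card (X × Y) * correctCountOfType W φ C v := by
  classical
  rw [← Fintype.sum_prod_type'] at hpos ⊢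
  obtain ⟨⟨y₀, m₀⟩, -, h_le⟩ := exists_sum_le_mul_sum_letterCount_eq univ
    (fun ym : (Fin n → Y) × Fin M ↦ fun i ↦ (C ym.2 i, ym.1 i)) hpos
  set v : Fin n → X × Y := fun i ↦ (C m₀ i, y₀ i) with hv
  have sum_eq : ∑ ym : (Fin n → Y) × Fin M with
      letterCount (fun i ↦ (C ym.2 i, ym.1 i)) = letterCount v, correctCount W φ C ym.1 ym.2 =
        correctCountOfType W φ C v := by
    simp only [correctCountOfType, sum_filter, Fintype.sum_prod_type, jointCount_eq_letterCount]
  rw [sum_eq] at h_le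
  refine ⟨v, fun i ↦ ((hW _).1 _).lt_of_ne' fun h_zero ↦ (hpos.trans_le h_le).not_ge ?_, h_le⟩
  refine mul_nonpos_of_nonneg_of_nonpos (by positivity) <|
    sum_nonpos fun y _ ↦ sum_nonpos fun m hm ↦ ?_
  refine (correctCount_le_mul_wordProb hW hφ C y m).trans_eq ?_
  rw [wordProb_eq_prod_of_jointCount_eq (mem_filter.1 hm).2, prod_eq_zero (mem_univ i) h_zero,
    mul_zero]

theorem correctCountOfType_le_exp (hW : IsKernel W) (hφ : IsDecoder φ)
    (hv : ∀ i, 0 < uncurry W (v i)) :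
    correctCountOfType W φ C v ≤ M * N * exp (-(n * (expLog (empirical v) (empirical v) -
      expLog (marginal Prod.fst (empirical v) ∘ Prod.fst) (empirical v) -
      expLog (uncurry W) (empirical v)))) := by
  calc correctCountOfType W φ C v
      ≤ ∑ y, ∑ m with jointCount (C m) y = letterCount v, N * ∏ i, uncurry W (v i) := by
        refine sum_le_sum fun y _ ↦ sum_le_sum fun m hm ↦ ?_
        rw [← wordProb_eq_prod_of_jointCount_eq (mem_filter.1 hm).2]
        exact correctCount_le_mul_wordProb hW hφ C y m
    _ = ∑ m, #{y | jointCount (C m) y = letterCount v} * (N * ∏ i, uncurry W (v i)) := by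
        simp only [← nsmul_eq_mul, ← sum_const, sum_filter]
        exact sum_comm
    _ ≤ ∑ _m : Fin M, exp (-(n * (expLog (empirical v) (empirical v) -
          expLog (marginal Prod.fst (empirical v) ∘ Prod.fst) (empirical v)))) *
          (N * exp (n * expLog (uncurry W) (empirical v))) := by
        rw [prod_eq_exp_expLog hv]
        gcongr with m
        simp only [jointCount_eq_letterCount]
        exact card_filter_letterCount_le_exp Prod.fst (fun _ ↦ Prod.mk_right_injective _)
          (fun _ _ _ ↦ rfl) (empirical_nonneg v) (empirical_pos v)
    _ = _ := by
        rw [sum_const, card_univ, Fintype.card_fin, nsmul_eq_mul, mul_left_comm (exp _), ← exp_add,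
          ← mul_assoc]
        congr 2
        ring

theorem sum_correctCount_of_jointCount_le (hW : IsKernel W) (hφ : IsDecoder φ)
    (hv : ∀ i, 0 < uncurry W (v i)) (y : Fin n → Y) :
    ∑ m with jointCount (C m) y = letterCount v, correctCount W φ C y m ≤
      log M + 2 * (N * exp (n * expLog (uncurry W) (empirical v))) + 1 := by
  set a := log M + 2 * (N * exp (n * expLog (uncurry W) (empirical v))) with ha
  refine (sum_correctCount_le hW hφ C y _ (by positivity : 0 ≤ a)).trans (add_le_add_right ?_ a)
  calc ∑ m with jointCount (C m) y = letterCount v, exp (2 * (N * wordProb W (C m) y) - a)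
      ≤ ∑ _m : Fin M, exp (-log M) := by
        rw [sum_filter]
        refine sum_le_sum fun m _ ↦ ?_
        split_ifs with h
        · rw [wordProb_eq_prod_of_jointCount_eq h, prod_eq_exp_expLog hv, ha, sub_add_cancel_right]
        · positivity
    _ ≤ 1 := by
        rcases Nat.eq_zero_or_pos M with rfl | hM
        · simp
        · rw [sum_const, card_univ, Fintype.card_fin, nsmul_eq_mul, exp_neg,
            exp_log (Nat.cast_pos.2 hM)]
          exact mul_inv_le_one

theorem correctCountOfType_le_exp_mul (hn : n ≠ 0) (hW : IsKernel W) (hφ : IsDecoder φ)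
    (hv : ∀ i, 0 < uncurry W (v i)) :
    correctCountOfType W φ C v ≤
      exp (-(n * expLog (marginal Prod.snd (empirical v) ∘ Prod.snd) (empirical v))) *
        (log M + 2 * (N * exp (n * expLog (uncurry W) (empirical v))) + 1) := by
  set b := log M + 2 * (N * exp (n * expLog (uncurry W) (empirical v))) + 1
  set q := marginal Prod.snd (empirical v)
  have q_law : q ∈ stdSimplex ℝ Y :=
    marginal_mem_stdSimplex Prod.snd (empirical_mem_stdSimplex hn v)
  have le_prod (y : Fin n → Y) :
      ∑ m with jointCount (C m) y = letterCount v, correctCount W φ C y m ≤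
        (∏ i, q (y i)) * (exp (-(n * expLog (q ∘ Prod.snd) (empirical v))) * b) := by
    by_cases h : ∃ m, jointCount (C m) y = letterCount v
    · obtain ⟨m, hm⟩ := h
      rw [jointCount_eq_letterCount] at hm
      rw [show ∏ i, q (y i) = ∏ i, (q ∘ Prod.snd) (v i) from
          prod_eq_prod_of_letterCount_eq (q ∘ Prod.snd) hm,
        prod_eq_exp_expLog (f := q ∘ Prod.snd) fun i ↦ marginal_pos _ (empirical_nonneg v)
          (empirical_pos v i).ne', ← mul_assoc, ← exp_add, add_neg_cancel, exp_zero, one_mul]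
      exact sum_correctCount_of_jointCount_le hW hφ hv y
    · rw [filter_eq_empty_iff.2 fun m _ hm ↦ h ⟨m, hm⟩, sum_empty]
      exact mul_nonneg (prod_nonneg fun i _ ↦ q_law.1 _) (by positivity)
  refine (Finset.sum_le_sum fun y _ ↦ le_prod y).trans_eq ?_
  rw [← sum_mul, (prod_mem_stdSimplex fun _ ↦ q_law).2, one_mul]

theorem log_expSize_add_le (n : ℕ) {R : ℝ} (hR : 0 ≤ R) (K t : ℝ) :
    log (expSize n R) + 2 * (expSize n K * exp (n * t)) + 1 ≤
      (n * R + 3) * exp (n * max 0 (K + t)) := by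
  have log_le : log (expSize n R) ≤ n * R :=
    (log_le_log (Nat.cast_pos.2 (expSize_pos n hR)) (expSize_le n R)).trans_eq (log_exp _)
  have mul_exp_le : expSize n K * exp (n * t) ≤ exp (n * max 0 (K + t)) :=
    calc expSize n K * exp (n * t) ≤ exp (n * K) * exp (n * t) := by
          gcongr
          exact expSize_le n K
      _ = exp (n * (K + t)) := by rw [← exp_add, mul_add]
      _ ≤ exp (n * max 0 (K + t)) := by
          gcongr
          exact le_max_right _ _
  have one_le : 1 ≤ exp (n * max 0 (K + t)) := one_le_exp (by positivity)
  have : 0 ≤ n * R := by positivity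
  nlinarith

theorem inv_mul_correctCountOfType_le {R K : ℝ} (hR : 0 ≤ R) (hK : 0 ≤ K) (hn : n ≠ 0)
    (hW : IsKernel W) {φ : Decoder X Y n (expSize n R) (expSize n K)} (hφ : IsDecoder φ)
    (C : Codebook X n (expSize n R)) (hv : ∀ i, 0 < uncurry W (v i)) :
    (expSize n R * expSize n K : ℝ)⁻¹ * correctCountOfType W φ C v ≤ 4 * (n * R + 3) *
      exp (-(n * decodingExponent W (marginal Prod.fst (empirical v)) R K (empirical v)
        (empirical v))) := by
  have hM : (0 : ℝ) < expSize n R := Nat.cast_pos.2 (expSize_pos n hR)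
  have hN : (0 : ℝ) < expSize n K := Nat.cast_pos.2 (expSize_pos n hK)
  have bound_of_type := correctCountOfType_le_exp (C := C) hW hφ hv
  have bound_of_word := correctCountOfType_le_exp_mul (C := C) hn hW hφ hv
  unfold decodingExponent
  set eQ := expLog (empirical v) (empirical v)
  set eX := expLog (marginal Prod.fst (empirical v) ∘ Prod.fst) (empirical v)
  set eY := expLog (marginal Prod.snd (empirical v) ∘ Prod.snd) (empirical v)
  set eW := expLog (uncurry W) (empirical v)
  rcases le_total (R - (eQ - eX - eY) - max 0 (-eW - K)) 0 with h | h
  · rw [max_eq_left h, add_zero]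
    calc (expSize n R * expSize n K : ℝ)⁻¹ * correctCountOfType W φ C v
        ≤ exp (-(n * (eQ - eX - eW))) := (inv_mul_le_iff₀ (by positivity)).2 bound_of_type
      _ ≤ _ := le_mul_of_one_le_left (exp_pos _).le (by linarith [show 0 ≤ n * R by positivity])
  · rw [max_eq_right h]
    have max_eq : max 0 (-eW - K) = max 0 (K + eW) - (K + eW) := by
      rw [← max_sub_sub_right, sub_self, max_comm]
      ring_nf
    calc (expSize n R * expSize n K : ℝ)⁻¹ * correctCountOfType W φ C v
        ≤ (2 * exp (-(n * R)) * (2 * exp (-(n * K)))) *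
            (exp (-(n * eY)) * ((n * R + 3) * exp (n * max 0 (K + eW)))) := by
          rw [mul_inv]
          gcongr
          · exact sum_nonneg fun y _ ↦ sum_nonneg fun m _ ↦ correctCount_nonneg hW hφ C y m
          · exact inv_expSize_le n hR
          · exact inv_expSize_le n hK
          · exact bound_of_word.trans (mul_le_mul_of_nonneg_left
              (log_expSize_add_le n hR K eW) (exp_pos _).le)
      _ = 4 * (n * R + 3) *
            exp (-(n * R) + -(n * K) + -(n * eY) + n * max 0 (K + eW)) := by
          simp only [exp_add]
          ring
      _ = _ := by
          rw [max_eq]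
          congr 2
          ring

theorem le_decodingExponent_of_le_Ec {R K E : ℝ} (hE : E ≤ Ec W R K) {Q : X × Y → ℝ}
    (hQ : Q ∈ stdSimplex ℝ (X × Y)) (hQW : support Q ⊆ support (uncurry W)) :
    E ≤ decodingExponent W (marginal Prod.fst Q) R K Q Q := by
  rw [← EReal.coe_le_coe_iff, ← jointObjective_eq_coe R K hQ.1
    ((support_subset_jointXY_marginal_iff hQ.1).2 hQW)]
  exact hE.trans ((Ec_eq_iInf W R K).trans_le (iInf₂_le Q hQ))

theorem one_sub_errProb_le {R K E : ℝ} (hR : 0 ≤ R) (hK : 0 ≤ K) (hE : E ≤ Ec W R K) (hn : n ≠ 0)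
    (hW : IsKernel W) {φ : Decoder X Y n (expSize n R) (expSize n K)} (hφ : IsDecoder φ)
    (C : Codebook X n (expSize n R)) :
    1 - errProb W φ C ≤
      ((n : ℝ) + 1) ^ Fintype.card (X × Y) * (4 * (n * R + 3)) * exp (-(n * E)) := by
  rw [one_sub_errProb (expSize_pos n hR).ne' (expSize_pos n hK).ne' hW]
  rcases (sum_nonneg fun y _ ↦ sum_nonneg fun m _ ↦
    correctCount_nonneg hW hφ C y m).eq_or_lt with h | hpos
  · rw [← h, mul_zero]
    positivity
  obtain ⟨v, hv, h_le⟩ := exists_sum_correctCount_le hW hφ hpos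
  calc (expSize n R * expSize n K : ℝ)⁻¹ * ∑ y, ∑ m, correctCount W φ C y m
      ≤ ((n : ℝ) + 1) ^ Fintype.card (X × Y) *
          ((expSize n R * expSize n K : ℝ)⁻¹ * correctCountOfType W φ C v) := by
        rw [mul_left_comm]
        gcongr
    _ ≤ ((n : ℝ) + 1) ^ Fintype.card (X × Y) * (4 * (n * R + 3) * exp (-(n * E))) := by
        refine mul_le_mul_of_nonneg_left ?_ (by positivity)
        refine (inv_mul_correctCountOfType_le hR hK hn hW hφ C hv).trans ?_
        gcongr
        exact le_decodingExponent_of_le_Ec hE (empirical_mem_stdSimplex hn v)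
          (support_empirical_subset hv)
    _ = _ := (mul_assoc _ _ _).symm

end Converse

section UniformChoice

variable {M : ℕ}

theorem uniformChoice_nonneg (S : Finset (Fin M)) (m : Fin M) : 0 ≤ uniformChoice S m := by
  unfold uniformChoice
  split_ifs <;> positivity

theorem sum_mul_uniformChoice (S : Finset (Fin M)) (f : Fin M → ℝ) :
    ∑ m, f m * uniformChoice S m = (∑ m ∈ S, f m) / #S := by
  simp only [uniformChoice, mul_ite, mul_zero, mul_one_div]
  rw [sum_ite_mem, univ_inter, sum_div]

theorem sum_uniformChoice_le_one (S : Finset (Fin M)) : ∑ m, uniformChoice S m ≤ 1 := by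
  simpa using (sum_mul_uniformChoice S fun _ ↦ 1).trans_le (by simpa using div_self_le_one (#S : ℝ))

end UniformChoice

section MaximumLikelihood

variable {X Y : Type*} {n M N : ℕ}

theorem transProb_eq_letterCount_div (c : Clouds Y n M N) (m : Fin M) (y : Fin n → Y) :
    transProb c m y = letterCount (c m) y / N := by
  unfold transProb letterCount
  congr!

variable [Fintype Y]

theorem isDecoder_mlDecoder : IsDecoder (mlDecoder X Y n M N) :=
  ⟨fun _ _ _ _ ↦ uniformChoice_nonneg _ _, fun _ _ _ ↦ sum_uniformChoice_le_one _⟩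

theorem isDecoder_typeDecoder [Fintype X] (τ : X × Y → ℕ) :
    IsDecoder (typeDecoder τ : Decoder X Y n M N) :=
  ⟨fun _ _ _ _ ↦ uniformChoice_nonneg _ _, fun _ _ _ ↦ sum_uniformChoice_le_one _⟩

theorem sum_letterCount_mul_le_mlDecoder (hN : N ≠ 0) (C : Codebook X n M) (c : Clouds Y n M N)
    (y : Fin n → Y) {p : Fin M → ℝ} (hp : 0 ≤ p) (hp_sum : ∑ m, p m ≤ 1) :
    ∑ m, letterCount (c m) y * p m ≤ ∑ m, letterCount (c m) y * mlDecoder X Y n M N C c y m := by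
  classical
  rcases isEmpty_or_nonempty (Fin M) with _ | _
  · simp
  obtain ⟨m₀, h_max⟩ := Finite.exists_max fun m ↦ letterCount (c m) y
  have transProb_le_iff (m m' : Fin M) :
      transProb c m' y ≤ transProb c m y ↔ letterCount (c m') y ≤ letterCount (c m) y := by
    rw [← Nat.cast_le (α := ℝ), transProb_eq_letterCount_div, transProb_eq_letterCount_div,
      div_le_div_iff_of_pos_right (Nat.cast_pos.2 (Nat.pos_of_ne_zero hN))]
  rw [mlDecoder, sum_mul_uniformChoice]
  simp only [transProb_le_iff]
  set S := univ.filter fun m ↦ ∀ m', letterCount (c m') y ≤ letterCount (c m) y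
  have eq_max : ∀ m ∈ S, (letterCount (c m) y : ℝ) = letterCount (c m₀) y := fun m hm ↦ by
    rw [le_antisymm (h_max m) ((mem_filter.1 hm).2 m₀)]
  have card_ne_zero : (#S : ℝ) ≠ 0 :=
    Nat.cast_ne_zero.2 (card_ne_zero_of_mem (mem_filter.2 ⟨mem_univ m₀, h_max⟩))
  rw [sum_congr rfl eq_max, sum_const, nsmul_eq_mul, mul_div_cancel_left₀ _ card_ne_zero]
  calc ∑ m, letterCount (c m) y * p m ≤ ∑ m, letterCount (c m₀) y * p m := by
        gcongr with m
        · exact hp m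
        · exact h_max m
    _ ≤ letterCount (c m₀) y := by
        rw [← mul_sum]
        exact mul_le_of_le_one_right (Nat.cast_nonneg _) hp_sum

theorem errProb_mlDecoder_le (hM : M ≠ 0) (hN : N ≠ 0) {W : X → Y → ℝ} (hW : IsKernel W)
    {φ : Decoder X Y n M N} (hφ : IsDecoder φ) (C : Codebook X n M) :
    errProb W (mlDecoder X Y n M N) C ≤ errProb W φ C := by
  rw [← sub_le_sub_iff_left 1, one_sub_errProb hM hN hW, one_sub_errProb hM hN hW]
  refine mul_le_mul_of_nonneg_left (sum_le_sum fun y _ ↦ ?_) (by positivity)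
  simp only [correctCount]
  rw [sum_comm, sum_comm (s := univ (α := Fin M))]
  simp only [← mul_sum]
  exact sum_le_sum fun c _ ↦ mul_le_mul_of_nonneg_left
    (sum_letterCount_mul_le_mlDecoder hN C c y (hφ.nonneg C c y) (hφ.sum_le_one C c y))
    ((instanceProb_mem_stdSimplex hW C).1 c)

/- Maximum-likelihood decoding is at least as good as guessing the message. -/
theorem one_sub_errProb_mlDecoder_pos (hM : M ≠ 0) (hN : N ≠ 0) {W : X → Y → ℝ}
    (hW : IsKernel W) (C : Codebook X n M) : 0 < 1 - errProb W (mlDecoder X Y n M N) C := by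
  set guess : Decoder X Y n M N := fun _ _ _ _ ↦ 1 / (M : ℝ) with h_guess
  have isDecoder_guess : IsDecoder guess :=
    ⟨fun _ _ _ _ ↦ by positivity, fun _ _ _ ↦ by simp [guess, hM]⟩
  have errProb_guess : errProb W guess C = 1 - 1 / M := by
    simp only [errProb, h_guess, sum_const, card_univ, Fintype.card_fin, nsmul_eq_mul, ← sum_mul,
      (instanceProb_mem_stdSimplex hW C).2]
    field_simp
  have := errProb_mlDecoder_le hM hN hW isDecoder_guess C
  have : 0 < 1 / (M : ℝ) := by positivity
  linarith

end MaximumLikelihood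

section RandomChoice

/- The tangent at `1 + μ` of `z ↦ 1 / z` makes the uniform choice linear in the other members of
`S`, so that only pairwise independence is needed to average it. -/
theorem le_uniformChoice {M : ℕ} {S : Finset (Fin M)} {m : Fin M} (hm : m ∈ S) {μ : ℝ}
    (hμ : 0 ≤ μ) : (1 + 2 * μ - #(S.erase m)) / (1 + μ) ^ 2 ≤ uniformChoice S m := by
  have card_pos : (0 : ℝ) < #S := Nat.cast_pos.2 (card_pos.2 ⟨m, hm⟩)
  rw [uniformChoice, if_pos hm, div_le_div_iff₀ (by positivity) card_pos, cast_card_erase_of_mem hm]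
  nlinarith [sq_nonneg ((#S : ℝ) - 1 - μ)]

variable {ι κ : Type*} [Fintype ι] [DecidableEq ι] [Fintype κ] {p : κ → ℝ}

theorem sum_prod_mul_apply (hp : ∑ k, p k = 1) (i : ι) (f : κ → ℝ) :
    ∑ ω : ι → κ, (∏ i, p (ω i)) * f (ω i) = ∑ k, p k * f k := by
  simpa using sum_pi_prod_mul_prod (fun _ ↦ hp) {i} fun _ ↦ f

theorem sum_prod_mul_apply_mul_apply (hp : ∑ k, p k = 1) {i j : ι} (hij : i ≠ j) (f g : κ → ℝ) :
    ∑ ω : ι → κ, (∏ i, p (ω i)) * (f (ω i) * g (ω j)) = (∑ k, p k * f k) * ∑ k, p k * g k := by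
  simpa [prod_pair hij, hij.symm] using
    sum_pi_prod_mul_prod (fun _ ↦ hp) {i, j} fun l ↦ if l = i then f else g

theorem div_one_add_le_sum_prod_mul (hp : p ∈ stdSimplex ℝ κ) {f a : κ → ℝ} (hf : 0 ≤ f)
    (ha : 0 ≤ a) {μ : ℝ} (hμ : Fintype.card ι * ∑ k, p k * a k ≤ μ) (i : ι) :
    (∑ k, p k * f k) / (1 + μ) ≤ ∑ ω : ι → κ, (∏ j, p (ω j)) *
      (f (ω i) * ((1 + 2 * μ - ∑ j ∈ univ.erase i, a (ω j)) / (1 + μ) ^ 2)) := by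
  have sum_f_nonneg : 0 ≤ ∑ k, p k * f k := sum_nonneg fun k _ ↦ mul_nonneg (hp.1 k) (hf k)
  have sum_a_nonneg : 0 ≤ ∑ k, p k * a k := sum_nonneg fun k _ ↦ mul_nonneg (hp.1 k) (ha k)
  have μ_nonneg : 0 ≤ μ := (mul_nonneg (Nat.cast_nonneg _) sum_a_nonneg).trans hμ
  have others_le : #(univ.erase i) * ∑ k, p k * a k ≤ μ :=
    (mul_le_mul_of_nonneg_right (Nat.cast_le.2 (card_le_univ _)) sum_a_nonneg).trans hμ
  have expand (ω : ι → κ) : (∏ j, p (ω j)) *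
      (f (ω i) * ((1 + 2 * μ - ∑ j ∈ univ.erase i, a (ω j)) / (1 + μ) ^ 2)) =
        ((∏ j, p (ω j)) * f (ω i) * (1 + 2 * μ) -
          ∑ j ∈ univ.erase i, (∏ j, p (ω j)) * (f (ω i) * a (ω j))) / (1 + μ) ^ 2 := by
    simp only [← mul_sum]
    ring
  calc (∑ k, p k * f k) / (1 + μ)
      = (∑ k, p k * f k) * (1 + 2 * μ - μ) / (1 + μ) ^ 2 := by
        field_simp
        ring
    _ ≤ (∑ k, p k * f k) * (1 + 2 * μ - #(univ.erase i) * ∑ k, p k * a k) / (1 + μ) ^ 2 := by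
        gcongr
    _ = _ := by
        simp only [expand, ← sum_div, sum_sub_distrib, ← sum_mul]
        rw [sum_prod_mul_apply hp.2, sum_comm, sum_congr rfl fun j hj ↦
          sum_prod_mul_apply_mul_apply hp.2 (ne_of_mem_erase hj).symm f a, sum_const, nsmul_eq_mul]
        ring

theorem div_one_add_le_sum_prod_mul_uniformChoice (hp : p ∈ stdSimplex ℝ κ) {r : κ → ℝ}
    (hr : 0 ≤ r) (A : κ → Prop) [DecidablePred A] {M : ℕ} {μ : ℝ} (hμ : M * ∑ k with A k, p k ≤ μ)
    (m : Fin M) :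
    (∑ k with A k, p k * r k) / (1 + μ) ≤
      ∑ ω : Fin M → κ, (∏ m, p (ω m)) * (r (ω m) * uniformChoice {m | A (ω m)} m) := by
  have μ_nonneg : 0 ≤ μ :=
    (mul_nonneg (Nat.cast_nonneg _) (sum_nonneg fun k _ ↦ hp.1 k)).trans hμ
  have average := div_one_add_le_sum_prod_mul hp (f := fun k ↦ if A k then r k else 0)
    (a := fun k ↦ if A k then 1 else 0) (fun k ↦ ite_nonneg (hr k) le_rfl)
    (fun k ↦ ite_nonneg zero_le_one le_rfl) (μ := μ)
    (by simpa [sum_filter] using hμ) m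
  simp only [mul_ite, mul_zero, mul_one, ← sum_filter, filter_erase, sum_const,
    nsmul_eq_mul] at average
  refine average.trans <| sum_le_sum fun ω _ ↦
    mul_le_mul_of_nonneg_left ?_ (prod_nonneg fun _ _ ↦ hp.1 _)
  split_ifs with hm
  · exact mul_le_mul_of_nonneg_left (le_uniformChoice (mem_filter.2 ⟨mem_univ m, hm⟩) μ_nonneg)
      (hr _)
  · rw [zero_mul]
    exact mul_nonneg (hr _) (uniformChoice_nonneg _ _)

end RandomChoice

section RandomCodebook

variable {X Y : Type*} [Fintype X] [Fintype Y] {n M N : ℕ} {W : X → Y → ℝ} {P : X → ℝ}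

theorem codebookProb_mem_stdSimplex (hP : P ∈ stdSimplex ℝ X) :
    (fun C : Codebook X n M ↦ ∏ m, ∏ i, P (C m i)) ∈ stdSimplex ℝ (Codebook X n M) :=
  prod_mem_stdSimplex fun _ ↦ prod_mem_stdSimplex fun _ ↦ hP

theorem one_sub_avgErrProb (W : X → Y → ℝ) (φ : Decoder X Y n M N) (hP : P ∈ stdSimplex ℝ X) :
    1 - avgErrProb W φ P =
      ∑ C : Codebook X n M, (∏ m, ∏ i, P (C m i)) * (1 - errProb W φ C) := by
  simp only [mul_sub, mul_one, sum_sub_distrib, (codebookProb_mem_stdSimplex hP).2, avgErrProb]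

theorem avgErrProb_mono (hP : P ∈ stdSimplex ℝ X) {φ ψ : Decoder X Y n M N}
    (h : ∀ C, errProb W φ C ≤ errProb W ψ C) : avgErrProb W φ P ≤ avgErrProb W ψ P :=
  sum_le_sum fun C _ ↦ mul_le_mul_of_nonneg_left (h C) ((codebookProb_mem_stdSimplex hP).1 C)

theorem exists_errProb_le_avgErrProb (W : X → Y → ℝ) (φ : Decoder X Y n M N)
    (hP : P ∈ stdSimplex ℝ X) : ∃ C, errProb W φ C ≤ avgErrProb W φ P := by
  have prob := codebookProb_mem_stdSimplex (n := n) (M := M) hP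
  obtain ⟨C₁, -⟩ := exists_ne_zero_of_sum_ne_zero (prob.2.trans_ne one_ne_zero)
  have : Nonempty (Codebook X n M) := ⟨C₁⟩
  obtain ⟨C₀, h_min⟩ := Finite.exists_min (errProb W φ)
  refine ⟨C₀, ?_⟩
  calc errProb W φ C₀ = ∑ C : Codebook X n M, (∏ m, ∏ i, P (C m i)) * errProb W φ C₀ := by
        rw [← sum_mul, prob.2, one_mul]
    _ ≤ avgErrProb W φ P := sum_le_sum fun C _ ↦ mul_le_mul_of_nonneg_left (h_min C) (prob.1 C)

/-- The joint law of the codeword and the cloud of one message under random coding. -/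
def messageProb (W : X → Y → ℝ) (P : X → ℝ) (k : (Fin n → X) × (Fin N → Fin n → Y)) : ℝ :=
  (∏ i, P (k.1 i)) * ∏ j, wordProb W k.1 (k.2 j)

theorem messageProb_mem_stdSimplex (hW : IsKernel W) (hP : P ∈ stdSimplex ℝ X) :
    messageProb W P ∈ stdSimplex ℝ ((Fin n → X) × (Fin N → Fin n → Y)) := by
  have word_law : (fun x : Fin n → X ↦ ∏ i, P (x i)) ∈ stdSimplex ℝ (Fin n → X) :=
    prod_mem_stdSimplex fun _ ↦ hP
  refine ⟨fun k ↦ mul_nonneg (word_law.1 k.1) ((cloudProb_mem_stdSimplex hW k.1).1 k.2), ?_⟩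
  simp only [messageProb, Fintype.sum_prod_type, ← mul_sum, (cloudProb_mem_stdSimplex hW _).2,
    mul_one, word_law.2]

theorem one_sub_avgErrProb_eq_sum (hM : M ≠ 0) (hN : N ≠ 0) (hW : IsKernel W)
    (φ : Decoder X Y n M N) (hP : P ∈ stdSimplex ℝ X) :
    1 - avgErrProb W φ P = (M * N : ℝ)⁻¹ * ∑ y, ∑ m,
      ∑ ω : Fin M → (Fin n → X) × (Fin N → Fin n → Y), (∏ m, messageProb W P (ω m)) *
        (letterCount (ω m).2 y * φ (fun m ↦ (ω m).1) (fun m ↦ (ω m).2) y m) := by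
  have sum_pairs (y : Fin n → Y) (m : Fin M) :
      ∑ C : Codebook X n M, (∏ m, ∏ i, P (C m i)) * correctCount W φ C y m =
        ∑ ω : Fin M → (Fin n → X) × (Fin N → Fin n → Y), (∏ m, messageProb W P (ω m)) *
          (letterCount (ω m).2 y * φ (fun m ↦ (ω m).1) (fun m ↦ (ω m).2) y m) :=
    calc ∑ C : Codebook X n M, (∏ m, ∏ i, P (C m i)) * correctCount W φ C y m
        = ∑ w : Codebook X n M × Clouds Y n M N, (∏ m, messageProb W P (w.1 m, w.2 m)) *
            (letterCount (w.2 m) y * φ w.1 w.2 y m) := by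
          simp only [correctCount, messageProb, Fintype.sum_prod_type, prod_mul_distrib, mul_assoc,
            ← mul_sum, instanceProb_eq_prod_wordProb]
      _ = _ := Fintype.sum_equiv (Equiv.arrowProdEquivProdArrow (Fin M) (fun _ ↦ Fin n → X)
          fun _ ↦ Fin N → Fin n → Y).symm _ _ fun _ ↦ rfl
  simp only [one_sub_avgErrProb W φ hP, one_sub_errProb hM hN hW, mul_left_comm _ (_⁻¹), ← mul_sum,
    ← sum_pairs]
  simp only [mul_sum]
  rw [sum_comm, sum_congr rfl fun y _ ↦ sum_comm]

open Classical in
theorem sum_messageProb_mul_letterCount (hW : IsKernel W) (P : X → ℝ) (y : Fin n → Y)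
    (τ : X × Y → ℕ) :
    ∑ k : (Fin n → X) × (Fin N → Fin n → Y) with jointCount k.1 y = τ ∧ ∃ j, k.2 j = y,
      messageProb W P k * letterCount k.2 y =
        N * ∑ x with jointCount x y = τ, ∏ i, jointXY P W (x i, y i) := by
  have sum_clouds (x : Fin n → X) : ∑ c : Fin N → Fin n → Y,
      messageProb W P (x, c) * letterCount c y = N * ∏ i, jointXY P W (x i, y i) := by
    simp only [messageProb, mul_assoc, ← mul_sum, jointXY, prod_mul_distrib]
    rw [sum_prod_mul_letterCount (wordProb_mem_stdSimplex hW x), mul_left_comm, wordProb]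
  rw [sum_filter, Fintype.sum_prod_type, sum_filter, mul_sum]
  refine sum_congr rfl fun x _ ↦ ?_
  by_cases h : jointCount x y = τ
  · rw [if_pos h, ← sum_clouds]
    refine sum_congr rfl fun c _ ↦ ?_
    simp +contextual [h, exists_eq_iff_letterCount_ne_zero]
  · simp [h]

open Classical in
theorem sum_messageProb_le (hW : IsKernel W) (hP : P ∈ stdSimplex ℝ X) (y : Fin n → Y)
    (τ : X × Y → ℕ) :
    ∑ k : (Fin n → X) × (Fin N → Fin n → Y) with jointCount k.1 y = τ ∧ ∃ j, k.2 j = y,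
      messageProb W P k ≤
        ∑ x with jointCount x y = τ, (∏ i, P (x i)) * min 1 (N * wordProb W x y) := by
  have prob_exists_le (x : Fin n → X) : ∑ c : Fin N → Fin n → Y with ∃ j, c j = y,
      ∏ j, wordProb W x (c j) ≤ min 1 (N * wordProb W x y) := by
    refine le_min ?_ ?_
    · exact (sum_le_univ_sum_of_nonneg (cloudProb_mem_stdSimplex hW x).1).trans_eq
        (cloudProb_mem_stdSimplex hW x).2
    · rw [← sum_prod_mul_letterCount (wordProb_mem_stdSimplex hW x), sum_filter]
      refine sum_le_sum fun c _ ↦ ?_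
      split_ifs with h
      · exact le_mul_of_one_le_right ((cloudProb_mem_stdSimplex hW x).1 c) <|
          Nat.one_le_cast.2 (Nat.one_le_iff_ne_zero.2 (exists_eq_iff_letterCount_ne_zero.1 h))
      · exact mul_nonneg ((cloudProb_mem_stdSimplex hW x).1 c) (Nat.cast_nonneg _)
  rw [sum_filter, Fintype.sum_prod_type, sum_filter]
  refine sum_le_sum fun x _ ↦ ?_
  by_cases h : jointCount x y = τ
  · simp only [h, true_and, if_true, messageProb, ← sum_filter, ← mul_sum]
    exact mul_le_mul_of_nonneg_left (prob_exists_le x) (prod_nonneg fun _ _ ↦ hP.1 _)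
  · simp [h]

theorem sum_sum_prod_jointCount_eq (q : X × Y → ℝ) (v : Fin n → X × Y) :
    ∑ y : Fin n → Y, ∑ x with jointCount x y = letterCount v, ∏ i, q (x i, y i) =
      typeClassProb q v := by
  simp only [typeClassProb, sum_filter, jointCount_eq_letterCount]
  rw [sum_comm, ← Fintype.sum_prod_type']
  exact Fintype.sum_equiv (Equiv.arrowProdEquivProdArrow (Fin n) (fun _ ↦ X) fun _ ↦ Y).symm _ _
    fun _ ↦ rfl

theorem typeClassProb_div_le_one_sub_avgErrProb (hM : M ≠ 0) (hN : N ≠ 0) (hW : IsKernel W)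
    (hP : P ∈ stdSimplex ℝ X) (v : Fin n → X × Y) {μ : ℝ}
    (hμ : ∀ y : Fin n → Y, M * ∑ x with jointCount x y = letterCount v,
      (∏ i, P (x i)) * min 1 (N * wordProb W x y) ≤ μ) :
    typeClassProb (jointXY P W) v / (1 + μ) ≤
      1 - avgErrProb W (typeDecoder (letterCount v) : Decoder X Y n M N) P := by
  classical
  have correct_ge (y : Fin n → Y) (m : Fin M) :=
    div_one_add_le_sum_prod_mul_uniformChoice (messageProb_mem_stdSimplex hW hP)
      (r := fun k : (Fin n → X) × (Fin N → Fin n → Y) ↦ (letterCount k.2 y : ℝ))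
      (fun _ ↦ Nat.cast_nonneg _) (fun k ↦ jointCount k.1 y = letterCount v ∧ ∃ j, k.2 j = y)
      ((mul_le_mul_of_nonneg_left (sum_messageProb_le hW hP y _) (Nat.cast_nonneg M)).trans (hμ y))
      m
  rw [one_sub_avgErrProb_eq_sum hM hN hW _ hP, ← sum_sum_prod_jointCount_eq]
  refine le_trans (le_of_eq ?_) (mul_le_mul_of_nonneg_left
    (sum_le_sum fun y _ ↦ sum_le_sum fun m _ ↦ correct_ge y m) (by positivity))
  simp only [sum_messageProb_mul_letterCount hW, sum_const, card_univ, Fintype.card_fin,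
    nsmul_eq_mul, mul_div_assoc, ← mul_sum, ← sum_div]
  field_simp

end RandomCodebook

section Achievability

variable {X Y : Type*} [Fintype X] [Fintype Y] {n : ℕ} {W : X → Y → ℝ} {P : X → ℝ}
  {Q : X × Y → ℝ} {v : Fin n → X × Y}

theorem min_one_expSize_mul_exp_le (n : ℕ) (K a : ℝ) :
    min 1 (expSize n K * exp (n * a)) ≤ exp (-(n * max 0 (-a - K))) := by
  rcases max_cases 0 (-a - K) with ⟨h, -⟩ | ⟨h, -⟩
  · simp [h]
  · refine (min_le_right _ _).trans ?_
    calc expSize n K * exp (n * a) ≤ exp (n * K) * exp (n * a) := by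
          gcongr
          exact expSize_le n K
      _ = exp (-(n * max 0 (-a - K))) := by
          rw [h, ← exp_add]
          ring_nf

theorem expSize_mul_sum_le_exp (hQ : 0 ≤ Q) (hQv : ∀ i, 0 < Q (v i))
    (hPv : ∀ i, 0 < (P ∘ Prod.fst) (v i)) (hWv : ∀ i, 0 < uncurry W (v i)) (R K : ℝ)
    (y : Fin n → Y) :
    expSize n R * ∑ x with jointCount x y = letterCount v,
        (∏ i, P (x i)) * min 1 (expSize n K * wordProb W x y) ≤
      exp (n * (R - (expLog Q (empirical v) - expLog (P ∘ Prod.fst) (empirical v) -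
        expLog (marginal Prod.snd Q ∘ Prod.snd) (empirical v)) -
          max 0 (-expLog (uncurry W) (empirical v) - K))) := by
  set eQ := expLog Q (empirical v)
  set eP := expLog (P ∘ Prod.fst) (empirical v)
  set eY := expLog (marginal Prod.snd Q ∘ Prod.snd) (empirical v)
  set eW := expLog (uncurry W) (empirical v)
  have term_le (x : Fin n → X) (hx : jointCount x y = letterCount v) :
      (∏ i, P (x i)) * min 1 (expSize n K * wordProb W x y) ≤
        exp (n * eP) * exp (-(n * max 0 (-eW - K))) := by
    rw [wordProb_eq_prod_of_jointCount_eq hx, prod_eq_exp_expLog hWv,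
      show ∏ i, P (x i) = ∏ i, (P ∘ Prod.fst) (v i) from
        prod_eq_prod_of_letterCount_eq (P ∘ Prod.fst) (jointCount_eq_letterCount x y ▸ hx),
      prod_eq_exp_expLog hPv]
    exact mul_le_mul_of_nonneg_left (min_one_expSize_mul_exp_le n K eW) (exp_pos _).le
  have card_le : #{x | jointCount x y = letterCount v} ≤ exp (-(n * (eQ - eY))) := by
    simp only [jointCount_eq_letterCount]
    exact card_filter_letterCount_le_exp Prod.snd (φ := fun i x ↦ (x, y i))
      (fun _ ↦ Prod.mk_left_injective _) (fun _ _ _ ↦ rfl) hQ hQv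
  calc expSize n R * ∑ x with jointCount x y = letterCount v,
        (∏ i, P (x i)) * min 1 (expSize n K * wordProb W x y)
      ≤ expSize n R * ∑ x with jointCount x y = letterCount v,
          exp (n * eP) * exp (-(n * max 0 (-eW - K))) := by
        exact mul_le_mul_of_nonneg_left
          (sum_le_sum fun x hx ↦ term_le x (mem_filter.1 hx).2) (Nat.cast_nonneg _)
    _ ≤ exp (n * R) * (exp (-(n * (eQ - eY))) * (exp (n * eP) * exp (-(n * max 0 (-eW - K))))) := by
        rw [sum_const, nsmul_eq_mul]
        gcongr
        exact expSize_le n R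
    _ = _ := by
        simp only [← exp_add]
        ring_nf

theorem typeClassProb_jointXY (hQv : ∀ i, 0 < Q (v i)) (hPv : ∀ i, 0 < (P ∘ Prod.fst) (v i))
    (hWv : ∀ i, 0 < uncurry W (v i)) :
    typeClassProb (jointXY P W) v = typeClassProb Q v * exp (-(n * (expLog Q (empirical v) -
      expLog (P ∘ Prod.fst) (empirical v) - expLog (uncurry W) (empirical v)))) := by
  have prod_jointXY : ∏ i, jointXY P W (v i) = (∏ i, (P ∘ Prod.fst) (v i)) * ∏ i, uncurry W (v i) :=
    prod_mul_distrib
  have change_of_measure := typeClassProb_mul_prod (jointXY P W) Q v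
  rw [prod_jointXY, prod_eq_exp_expLog hQv, prod_eq_exp_expLog hPv, prod_eq_exp_expLog hWv,
    ← eq_div_iff (exp_pos _).ne', mul_div_assoc, ← exp_add, ← exp_sub] at change_of_measure
  rw [change_of_measure]
  ring_nf

theorem le_one_sub_PeRandomType {R K : ℝ} (hR : 0 ≤ R) (hK : 0 ≤ K) (hW : IsKernel W)
    (hP : P ∈ stdSimplex ℝ X) (hQ : 0 ≤ Q) (hQP : support Q ⊆ support (jointXY P W))
    (hv : ∀ i, 0 < Q (v i)) :
    typeClassProb Q v / 2 * exp (-(n * decodingExponent W P R K Q (empirical v))) ≤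
      1 - PeRandomType W R K P n (letterCount v) := by
  obtain ⟨hQ_P, hQ_W⟩ := Set.subset_inter_iff.1 (hQP.trans_eq (support_jointXY P W))
  have hPv (i : Fin n) : 0 < (P ∘ Prod.fst) (v i) := (hP.1 _).lt_of_ne' (hQ_P (hv i).ne')
  have hWv (i : Fin n) : 0 < uncurry W (v i) := ((hW _).1 _).lt_of_ne' (hQ_W (hv i).ne')
  have random_coding := typeClassProb_div_le_one_sub_avgErrProb (expSize_pos n hR).ne'
    (expSize_pos n hK).ne' hW hP v (expSize_mul_sum_le_exp hQ hv hPv hWv R K)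
  refine le_trans ?_ random_coding
  rw [typeClassProb_jointXY hv hPv hWv, decodingExponent, le_div_iff₀ (by positivity)]
  set d := expLog Q (empirical v) - expLog (P ∘ Prod.fst) (empirical v) -
    expLog (uncurry W) (empirical v)
  set s := R - _ - max 0 (-expLog (uncurry W) (empirical v) - K)
  have one_add_le : 1 + exp (n * s) ≤ 2 * exp (n * max 0 s) := by
    have : 1 ≤ exp (n * max 0 s) := one_le_exp (by positivity)
    have : exp (n * s) ≤ exp (n * max 0 s) := by
      gcongr
      exact le_max_right _ _
    linarith
  have typeClassProb_nonneg : 0 ≤ typeClassProb Q v :=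
    sum_nonneg fun _ _ ↦ prod_nonneg fun _ _ ↦ hQ _
  calc typeClassProb Q v / 2 * exp (-(n * (d + max 0 s))) * (1 + exp (n * s))
      ≤ typeClassProb Q v / 2 * exp (-(n * (d + max 0 s))) * (2 * exp (n * max 0 s)) := by gcongr
    _ = typeClassProb Q v * (exp (-(n * (d + max 0 s))) * exp (n * max 0 s)) := by ring
    _ = typeClassProb Q v * exp (-(n * d)) := by
        rw [← exp_add]
        ring_nf

end Achievability

section Exponents

theorem expo_le_expo (n : ℕ) {p q : ℝ} (hp : 0 < p) (hpq : p ≤ q) : expo n q ≤ expo n p :=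
  mul_le_mul_of_nonpos_left (log_le_log hp hpq) (neg_nonpos.2 (by positivity))

theorem expo_exp (n : ℕ) (t : ℝ) : expo n (exp t) = -(t / n) := by
  rw [expo, log_exp]
  ring

variable {X Y : Type*} [Fintype X] [Fintype Y] {n : ℕ} {W : X → Y → ℝ} {P : X → ℝ} {R K : ℝ}

theorem sub_le_expo_one_sub_Pe {E : ℝ} (hR : 0 ≤ R) (hK : 0 ≤ K) (hE : E ≤ Ec W R K) (hn : n ≠ 0)
    (hW : IsKernel W) (C : Codebook X n (expSize n R)) :
    E - ((Fintype.card (X × Y) + 1 : ℕ) * log ((n : ℝ) + 1) + log (4 * (R + 3))) / n ≤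
      expo n (1 - Pe W K C) := by
  set k := Fintype.card (X × Y)
  set a := ((k + 1 : ℕ) : ℝ) * log ((n : ℝ) + 1)
  have Pe_bound : 1 - Pe W K C ≤ exp (a + log (4 * (R + 3)) - n * E) :=
    calc 1 - Pe W K C
        ≤ ((n : ℝ) + 1) ^ k * (4 * (n * R + 3)) * exp (-(n * E)) :=
          one_sub_errProb_le hR hK hE hn hW isDecoder_mlDecoder C
      _ ≤ ((n : ℝ) + 1) ^ k * ((n + 1) * (4 * (R + 3))) * exp (-(n * E)) := by
          gcongr ?_ * ?_ * ?_
          linarith [Nat.cast_nonneg (α := ℝ) n]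
      _ = exp (a + log (4 * (R + 3)) - n * E) := by
          rw [← mul_assoc, ← pow_succ, natCast_add_one_pow_eq_exp, sub_eq_add_neg, exp_add,
            exp_add, exp_log (by positivity)]
  calc E - (a + log (4 * (R + 3))) / n = expo n (exp (a + log (4 * (R + 3)) - n * E)) := by
        rw [expo_exp]
        field_simp
        ring
    _ ≤ expo n (1 - Pe W K C) :=
        expo_le_expo n (one_sub_errProb_mlDecoder_pos (expSize_pos n hR).ne' (expSize_pos n hK).ne'
          hW C) Pe_bound

theorem iInf_expo_one_sub_Pe_le (hP : P ∈ stdSimplex ℝ X) (hpos : 0 < 1 - PeRandom W R K P n) :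
    ⨅ C : Codebook X n (expSize n R), (expo n (1 - Pe W K C) : EReal) ≤
      expo n (1 - PeRandom W R K P n) := by
  obtain ⟨C, hC⟩ := exists_errProb_le_avgErrProb W (mlDecoder X Y n _ (expSize n K)) hP
  exact iInf_le_of_le C (EReal.coe_le_coe (expo_le_expo n hpos (sub_le_sub_left hC 1)))

theorem PeRandom_le_PeRandomType (hR : 0 ≤ R) (hK : 0 ≤ K) (hW : IsKernel W)
    (hP : P ∈ stdSimplex ℝ X) (τ : X × Y → ℕ) :
    PeRandom W R K P n ≤ PeRandomType W R K P n τ :=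
  avgErrProb_mono hP
    (errProb_mlDecoder_le (expSize_pos n hR).ne' (expSize_pos n hK).ne' hW
      (isDecoder_typeDecoder τ))

theorem expo_one_sub_PeRandomType_le {Q : X × Y → ℝ} {v : Fin n → X × Y} {k : ℕ} (hR : 0 ≤ R)
    (hK : 0 ≤ K) (hW : IsKernel W) (hP : P ∈ stdSimplex ℝ X) (hQ : 0 ≤ Q)
    (hQP : support Q ⊆ support (jointXY P W)) (hn : n ≠ 0) (hv : ∀ i, 0 < Q (v i))
    (hge : 1 ≤ ((n : ℝ) + 1) ^ k * typeClassProb Q v) :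
    0 < 1 - PeRandomType W R K P n (letterCount v) ∧
      expo n (1 - PeRandomType W R K P n (letterCount v)) ≤
        decodingExponent W P R K Q (empirical v) + (k * log ((n : ℝ) + 1) + log 2) / n := by
  set d := decodingExponent W P R K Q (empirical v)
  set a := (k : ℝ) * log ((n : ℝ) + 1)
  rw [natCast_add_one_pow_eq_exp] at hge
  have exp_le : exp (-(a + log 2) - n * d) ≤ 1 - PeRandomType W R K P n (letterCount v) :=
    calc exp (-(a + log 2) - n * d) = exp (-a) / 2 * exp (-(n * d)) := by
          rw [sub_eq_add_neg, exp_add, neg_add, exp_add, exp_neg (log 2), exp_log two_pos,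
            ← div_eq_mul_inv]
      _ ≤ typeClassProb Q v / 2 * exp (-(n * d)) := by
          gcongr
          rwa [exp_neg, inv_le_iff_one_le_mul₀' (exp_pos a)]
      _ ≤ _ := le_one_sub_PeRandomType hR hK hW hP hQ hQP hv
  refine ⟨(exp_pos _).trans_le exp_le, (expo_le_expo n (exp_pos _) exp_le).trans_eq ?_⟩
  rw [expo_exp]
  field_simp
  ring

theorem exists_tendsto_Ec_le_expo [Nonempty X] (hR : 0 ≤ R) (hK : 0 ≤ K) (hW : IsKernel W) :
    ∃ l : ℕ → EReal, Tendsto l atTop (𝓝 (Ec W R K)) ∧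
      ∀ᶠ n in atTop, l n ≤ ⨅ C : Codebook X n (expSize n R), (expo n (1 - Pe W K C) : EReal) := by
  obtain ⟨P, hP, hPE⟩ := (isLeast_EcP hW R K).1
  obtain ⟨Q, hQ, hQP, hQE⟩ := exists_jointObjective_eq_EcP hW hP R K
  have hE : (decodingExponent W P R K Q Q : EReal) = Ec W R K := by
    rw [← jointObjective_eq_coe R K hQ.1 hQP, hQE, ← hPE]
  have correction := (tendsto_log_div (Fintype.card (X × Y) + 1 : ℕ) (log (4 * (R + 3)))).const_sub
    (decodingExponent W P R K Q Q)
  rw [sub_zero] at correction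
  refine ⟨_, hE ▸ continuous_coe_real_ereal.continuousAt.tendsto.comp correction, ?_⟩
  filter_upwards [eventually_ne_atTop 0] with n hn
  exact le_iInf fun C ↦ EReal.coe_le_coe (sub_le_expo_one_sub_Pe hR hK hE.le hn hW C)

theorem exists_types_expo_le_tendsto_EcP (hR : 0 ≤ R) (hK : 0 ≤ K) (hW : IsKernel W)
    (hP : P ∈ stdSimplex ℝ X) :
    ∃ τ : ℕ → X × Y → ℕ, (∀ n, ∑ z, τ n z = n) ∧
      (∀ᶠ n in atTop, 0 < 1 - PeRandomType W R K P n (τ n)) ∧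
      ∃ u : ℕ → EReal, Tendsto u atTop (𝓝 (EcP W P R K)) ∧
        ∀ᶠ n in atTop, (expo n (1 - PeRandomType W R K P n (τ n)) : EReal) ≤ u n := by
  obtain ⟨Q, hQ, hQP, hQE⟩ := exists_jointObjective_eq_EcP hW hP R K
  choose v hv hge using fun n ↦ exists_one_le_mul_typeClassProb n hQ
  have bound (n : ℕ) (hn : n ≠ 0) :=
    expo_one_sub_PeRandomType_le hR hK hW hP hQ.1 hQP hn (hv n) (hge n)
  have exponent_tendsto := ((continuous_decodingExponent W P R K Q).tendsto Q).comp
    (tendsto_empirical hQ hv hge)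
  have bound_tendsto := exponent_tendsto.add (tendsto_log_div (Fintype.card (X × Y)) (log 2))
  rw [add_zero] at bound_tendsto
  rw [← hQE, jointObjective_eq_coe R K hQ.1 hQP]
  refine ⟨fun n ↦ letterCount (v n), fun n ↦ sum_letterCount (v n), ?_, _,
    continuous_coe_real_ereal.continuousAt.tendsto.comp bound_tendsto, ?_⟩
  all_goals filter_upwards [eventually_ne_atTop 0] with n hn
  · exact (bound n hn).1
  · exact EReal.coe_le_coe (bound n hn).2

theorem exists_types_tendsto_expo [Nonempty X] (hR : 0 ≤ R) (hK : 0 ≤ K) (hW : IsKernel W)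
    (hP : P ∈ stdSimplex ℝ X) (hPE : EcP W P R K = Ec W R K) :
    Tendsto (fun n ↦ ⨅ C : Codebook X n (expSize n R), (expo n (1 - Pe W K C) : EReal)) atTop
      (𝓝 (Ec W R K)) ∧
    Tendsto (fun n ↦ (expo n (1 - PeRandom W R K P n) : EReal)) atTop (𝓝 (Ec W R K)) ∧
    ∃ τ : ℕ → X × Y → ℕ, (∀ n, ∑ z, τ n z = n) ∧
      (∀ᶠ n in atTop, 0 < 1 - PeRandomType W R K P n (τ n)) ∧
      Tendsto (fun n ↦ (expo n (1 - PeRandomType W R K P n (τ n)) : EReal)) atTop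
        (𝓝 (Ec W R K)) := by
  obtain ⟨l, hl, le_codebook⟩ := exists_tendsto_Ec_le_expo hR hK hW
  obtain ⟨τ, hτ, hpos, u, hu, type_le⟩ := exists_types_expo_le_tendsto_EcP hR hK hW hP
  rw [hPE] at hu
  have PeRandom_le (n : ℕ) : 1 - PeRandomType W R K P n (τ n) ≤ 1 - PeRandom W R K P n :=
    sub_le_sub_left (PeRandom_le_PeRandomType hR hK hW hP (τ n)) 1
  have codebook_le_random : ∀ᶠ n in atTop,
      ⨅ C : Codebook X n (expSize n R), (expo n (1 - Pe W K C) : EReal) ≤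
        expo n (1 - PeRandom W R K P n) :=
    hpos.mono fun n h ↦ iInf_expo_one_sub_Pe_le hP (h.trans_le (PeRandom_le n))
  have random_le_type : ∀ᶠ n in atTop, (expo n (1 - PeRandom W R K P n) : EReal) ≤
      expo n (1 - PeRandomType W R K P n (τ n)) :=
    hpos.mono fun n h ↦ EReal.coe_le_coe (expo_le_expo n h (PeRandom_le n))
  have le_random := le_codebook.and codebook_le_random |>.mono fun _ h ↦ h.1.trans h.2
  have random_le := random_le_type.and type_le |>.mono fun _ h ↦ h.1.trans h.2
  exact ⟨tendsto_of_tendsto_of_tendsto_of_le_of_le' hl hu le_codebook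
      (codebook_le_random.and random_le |>.mono fun _ h ↦ h.1.trans h.2),
    tendsto_of_tendsto_of_tendsto_of_le_of_le' hl hu le_random random_le,
    τ, hτ, hpos, tendsto_of_tendsto_of_tendsto_of_le_of_le' hl hu
      (le_random.and random_le_type |>.mono fun _ h ↦ h.1.trans h.2) type_le⟩

end Exponents

end

theorem theorem4 {X Y : Type*} [Fintype X] [Fintype Y] [Nonempty X]
    (W : X → Y → ℝ) (hW : IsKernel W) (R K : ℝ) (hR : 0 < R) (hK : 0 < K) :
    -- the minima defining `E_c(R, K)` and `E_c(P, R, K)` are attained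
    (∃ P ∈ stdSimplex ℝ X, ∃ U : X → Y → ℝ, IsKernel U ∧ EcObj W R K P U = Ec W R K) ∧
    (∀ P ∈ stdSimplex ℝ X, ∃ T ∈ stdSimplex ℝ Y, ∃ V : Y → X → ℝ,
      IsKernel V ∧ EcPObj W P R K T V = EcP W P R K) ∧
    -- `E_c(R, K) = min_P E_c(P, R, K)`
    IsLeast ((fun P => EcP W P R K) '' stdSimplex ℝ X) (Ec W R K) ∧
    -- the optimal exponent over all codebooks (a minimum over a finite set) converges to it
    Tendsto (fun n : ℕ => ⨅ C : Codebook X n (expSize n R), ((expo n (1 - Pe W K C) : ℝ) : EReal))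
      atTop (𝓝 (Ec W R K)) ∧
    -- random coding with any minimizing `P` achieves it, both with maximum-likelihood decoding and
    -- with decoders that anticipate a single joint type
    (∀ P ∈ stdSimplex ℝ X, EcP W P R K = Ec W R K →
      Tendsto (fun n : ℕ => ((expo n (1 - PeRandom W R K P n) : ℝ) : EReal))
        atTop (𝓝 (Ec W R K)) ∧
      ∃ τ : ℕ → X × Y → ℕ, (∀ n, ∑ z, τ n z = n) ∧
        (∀ᶠ n in atTop, 0 < 1 - PeRandomType W R K P n (τ n)) ∧
        Tendsto (fun n : ℕ => ((expo n (1 - PeRandomType W R K P n (τ n)) : ℝ) : EReal))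
          atTop (𝓝 (Ec W R K))) := by
  obtain ⟨P₀, hP₀, hmin⟩ := (isLeast_EcP hW R K).1
  refine ⟨exists_EcObj_eq_Ec hW R K, fun P hP ↦ exists_EcPObj_eq_EcP hW hP R K,
    isLeast_EcP hW R K, ?_, fun P hP hPE ↦ ?_⟩
  · exact (exists_types_tendsto_expo hR.le hK.le hW hP₀ hmin).1
  · exact (exists_types_tendsto_expo hR.le hK.le hW hP hPE).2
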